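/- Let $\alpha>0$ and $c>0$, and let $(m_n)_{n\ge 1}$ be nonnegative integers with $m_n/n\to\alpha$ as $n\to\infty$. For a real symmetric $n\times n$ matrix $W$ with eigenvalues $\lambda_1,\dots,\lambda_n$ (counted with multiplicity), let $\mu_W=\frac1n\sum_{i=1}^n\delta_{\lambda_i}$ be its spectral measure. For every integer $n\ge c$, let $A_n$ be a random $n\times m_n$ matrix with i.i.d. entries with the Bernoulli law of parameter $c/n$ (value $1$ with probability $c/n$, value $0$ with probability $1-c/n$), and let $X_n$ be a random $n\times m_n$ matrix with i.i.d. entries with the centered Bernoulli law of parameter $c/n$ (value $1-c/n$ with probability $c/n$, value $-c/n$ with probability $1-c/n$). All the matrices $A_n$ and $X_n$ are defined on one probability space, with an arbitrary joint law for different $n$. Put $W'_n=c^{-1}A_nA_n^{T}$ and $W_n=c^{-1}X_nX_n^{T}$. Then there exists a (deterministic) probability law $\mu_{\alpha,c}$ on $\mathbf R$, depending only on $\alpha$ and $c$, such that, almost surely, $\mu_{W'_n}$ converges weakly to $\mu_{\alpha,c}$ as $n\to\infty$; and, likewise, almost surely, $\mu_{W_n}$ converges weakly to the same law $\mu_{\alpha,c}$.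 -/

import Mathlib

open MeasureTheory ProbabilityTheory Filter Topology
open scoped ENNReal BoundedContinuousFunction

/-- The Bernoulli law of parameter `p` on `ℝ`: mass `p` at `1` and mass `1 - p` at `0`. -/
noncomputable def bernoulliLaw (p : unitInterval) : Measure ℝ :=
  bernoulliMeasure 1 0 p

/-- The centered Bernoulli law of parameter `p` on `ℝ`: mass `p` at `1 - p` and mass `1 - p`
at `-p`. -/
noncomputable def centeredBernoulliLaw (p : unitInterval) : Measure ℝ :=
  bernoulliMeasure (1 - (p : ℝ)) (-(p : ℝ)) p

/-- `X` is a random `n × m` real matrix on `(Ω, P)` whose entries are i.i.d. with law `ν`. -/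
structure HasIIDEntries {Ω : Type*} [MeasurableSpace Ω] (P : Measure Ω) {n m : ℕ}
    (X : Ω → Matrix (Fin n) (Fin m) ℝ) (ν : Measure ℝ) : Prop where
  /-- The entries are mutually independent. -/
  indep : iIndepFun (fun (p : Fin n × Fin m) (ω : Ω) => X ω p.1 p.2) P
  /-- Every entry has law `ν`. -/
  law : ∀ (i : Fin n) (j : Fin m), HasLaw (fun ω => X ω i j) ν P

/-- The matrix `c⁻¹ X Xᵀ`. -/
noncomputable def wishart (c : ℝ) {n m : ℕ} (X : Matrix (Fin n) (Fin m) ℝ) :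
    Matrix (Fin n) (Fin n) ℝ :=
  c⁻¹ • (X * X.transpose)

theorem wishart_isHermitian (c : ℝ) {n m : ℕ} (X : Matrix (Fin n) (Fin m) ℝ) :
    (wishart c X).IsHermitian := by
  simp [wishart, Matrix.IsHermitian, Matrix.conjTranspose_eq_transpose_of_trivial,
    Matrix.transpose_smul, Matrix.transpose_mul]

/-- The spectral measure of a real symmetric `n × n` matrix: the uniform probability measure on
its `n` eigenvalues, counted with multiplicity. -/
noncomputable def spectralMeasure {n : ℕ} {W : Matrix (Fin n) (Fin n) ℝ} (hW : W.IsHermitian) :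
    Measure ℝ :=
  (n : ℝ≥0∞)⁻¹ • ∑ i : Fin n, Measure.dirac (hW.eigenvalues i)

/-- Weak convergence of a sequence of measures on `ℝ`, tested on bounded continuous functions. -/
def WeaklyConverges (ν : ℕ → Measure ℝ) (μ : Measure ℝ) : Prop :=
  ∀ f : ℝ →ᵇ ℝ, Tendsto (fun n => ∫ x, f x ∂(ν n)) atTop (𝓝 (∫ x, f x ∂μ))

/-! ### Spectral measures, resolvent traces and low-rank perturbations -/

section

open Matrix

/-! All matrices are positive semidefinite, so their spectral measures live on `[0, ∞)` and can be
studied through the Stieltjes transform at `-s`, that is, the normalized resolvent trace `n⁻¹ tr (W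
+ s)⁻¹` for `s > 0`.

Mean. The trace of `(A Aᵀ)ᵏ` is a sum over closed bipartite walks, and by independence a walk of 0-1
entries has expectation `p ^ (number of distinct edges)`. Grouping walks by their coincidence
pattern and using that a connected graph has at most one more vertex than edges
(`card_image_add_card_image_le`), only tree patterns survive in the limit (`tendsto_sum_patterns`).
The limiting moments grow at most like `Cᵏ (2k)!` (`limitMoment_le`), which makes the moment problem
on `[0, ∞)` determinate (`HasNonnegMoments.eq`); hence the averaged spectral measures converge to a
law that depends only on `α` and `c`.

Fluctuations. Replacing a column of `A` changes `W` by rank at most 2, hence the unnormalized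
resolvent trace by at most `2 / s`, whatever `n` is (`abs_stieltjesSum_sub_le`). With about `α n`
independent columns, the bounded difference inequality makes deviations of size `ε n` exponentially
unlikely. Borel-Cantelli then gives almost sure convergence without any assumption on the joint law
for different `n`.

Centering. Adding the rank-one matrix with all entries `c / n` turns `X` into a Bernoulli matrix,
and the same rank bound shows that the limit is unchanged.

Conclusion. Stieltjes transforms at the countably many points `s = 1 + 1 / (q + 1)`, which
accumulate at `1`, already determine weak convergence on `[0, ∞)` (`weaklyConverges_of_stieltjes`).
-/

theorem integral_spectralMeasure {n : ℕ} {W : Matrix (Fin n) (Fin n) ℝ} (hW : W.IsHermitian)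
    (f : ℝ → ℝ) :
    ∫ x, f x ∂(spectralMeasure hW) = (n : ℝ)⁻¹ * ∑ i, f (hW.eigenvalues i) := by
  rw [spectralMeasure, integral_smul_measure, integral_finsetSum_measure]
  · simp
  · intro i _
    exact integrable_dirac (by simp)

theorem integrable_spectralMeasure {n : ℕ} {W : Matrix (Fin n) (Fin n) ℝ} (hn : n ≠ 0)
    (hW : W.IsHermitian) (f : ℝ → ℝ) : Integrable f (spectralMeasure hW) := by
  rw [spectralMeasure]
  refine Integrable.smul_measure ?_ (by simpa using hn)
  rw [integrable_finsetSum_measure]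
  intro i _
  exact integrable_dirac (by simp)

theorem isProbabilityMeasure_spectralMeasure {n : ℕ} {W : Matrix (Fin n) (Fin n) ℝ} (hn : n ≠ 0)
    (hW : W.IsHermitian) : IsProbabilityMeasure (spectralMeasure hW) where
  measure_univ := by
    simp only [spectralMeasure, Measure.smul_apply, Measure.coe_finsetSum, Finset.sum_apply,
      measure_univ, Finset.sum_const, Finset.card_univ, Fintype.card_fin, nsmul_eq_mul, mul_one,
      smul_eq_mul]
    exact ENNReal.inv_mul_cancel (by simpa using hn) (by simp)

theorem spectral_decomposition {n : ℕ} {W : Matrix (Fin n) (Fin n) ℝ} (hW : W.IsHermitian) :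
    W = hW.eigenvectorUnitary.1 * diagonal hW.eigenvalues * star hW.eigenvectorUnitary.1 := by
  conv_lhs => rw [hW.spectral_theorem, Unitary.conjStarAlgAut_apply]
  rfl

theorem trace_pow_eq_sum_eigenvalues {n : ℕ} {W : Matrix (Fin n) (Fin n) ℝ} (hW : W.IsHermitian)
    (k : ℕ) : (W ^ k).trace = ∑ i, hW.eigenvalues i ^ k := by
  have h : W ^ k =
      hW.eigenvectorUnitary.1 * diagonal (fun i => hW.eigenvalues i ^ k) *
        star hW.eigenvectorUnitary.1 := by
    induction k with
    | zero => simp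
    | succ k ih =>
      have hUU : star hW.eigenvectorUnitary.1 * hW.eigenvectorUnitary.1 = 1 :=
        Unitary.coe_star_mul_self _
      calc W ^ (k + 1) = W ^ k * W := pow_succ _ _
        _ = (hW.eigenvectorUnitary.1 * diagonal (fun i => hW.eigenvalues i ^ k) *
              star hW.eigenvectorUnitary.1) * (hW.eigenvectorUnitary.1 *
              diagonal hW.eigenvalues * star hW.eigenvectorUnitary.1) := by
          rw [ih, ← spectral_decomposition hW]
        _ = hW.eigenvectorUnitary.1 * diagonal (fun i => hW.eigenvalues i ^ k) *
              (star hW.eigenvectorUnitary.1 * hW.eigenvectorUnitary.1) *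
              diagonal hW.eigenvalues * star hW.eigenvectorUnitary.1 := by
          simp only [mul_assoc]
        _ = _ := by
          rw [hUU, mul_one, mul_assoc hW.eigenvectorUnitary.1, diagonal_mul_diagonal]
          simp only [pow_succ]
  rw [h, Matrix.trace_mul_comm, ← mul_assoc]
  simp [Matrix.trace]

theorem wishart_posSemidef {c : ℝ} (hc : 0 < c) {n m : ℕ} (X : Matrix (Fin n) (Fin m) ℝ) :
    (wishart c X).PosSemidef := by
  have := (Matrix.posSemidef_self_mul_conjTranspose X).smul (inv_nonneg.2 hc.le)
  rwa [Matrix.conjTranspose_eq_transpose_of_trivial] at this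

theorem trace_inv_add_smul_one {n : ℕ} {W : Matrix (Fin n) (Fin n) ℝ} (hW : W.PosSemidef)
    {s : ℝ} (hs : 0 < s) :
    ((W + s • (1 : Matrix (Fin n) (Fin n) ℝ))⁻¹).trace =
      ∑ i, (hW.isHermitian.eigenvalues i + s)⁻¹ := by
  set U := hW.isHermitian.eigenvectorUnitary.1 with hU
  set lam := hW.isHermitian.eigenvalues with hlam
  have hUU : U * star U = 1 := Unitary.coe_mul_star_self _
  have hUU' : star U * U = 1 := Unitary.coe_star_mul_self _
  have h1 : (W + s • (1 : Matrix (Fin n) (Fin n) ℝ)) * 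
      (U * diagonal (fun i => (lam i + s)⁻¹) * star U) = 1 := by
    have : W + s • (1 : Matrix (Fin n) (Fin n) ℝ) = U * diagonal (fun i => lam i + s) * star U := by
      have h2 : diagonal (fun i => lam i + s) = diagonal lam + s • (1 : Matrix (Fin n) (Fin n) ℝ) := by
        rw [← Matrix.diagonal_one, ← Matrix.diagonal_smul, Matrix.diagonal_add]
        simp
      rw [h2, mul_add, add_mul, ← spectral_decomposition]
      simp [hUU]
    rw [this]
    calc _ = U * diagonal (fun i => lam i + s) * (star U * U) *
          diagonal (fun i => (lam i + s)⁻¹) * star U := by simp only [mul_assoc]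
      _ = 1 := by
        rw [hUU', mul_one, mul_assoc U, diagonal_mul_diagonal]
        have : (fun i => (lam i + s) * (lam i + s)⁻¹) = fun _ => 1 := by
          ext i
          have := hW.eigenvalues_nonneg i
          exact mul_inv_cancel₀ (by positivity)
        rw [this, diagonal_one, mul_one, hUU]
  rw [Matrix.inv_eq_right_inv h1, Matrix.trace_mul_comm, ← mul_assoc, hUU', one_mul]
  simp [Matrix.trace]

theorem posDef_add_smul_one {n : ℕ} {W : Matrix (Fin n) (Fin n) ℝ} (hW : W.PosSemidef)
    {s : ℝ} (hs : 0 < s) : (W + s • (1 : Matrix (Fin n) (Fin n) ℝ)).PosDef :=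
  Matrix.PosDef.posSemidef_add hW (Matrix.PosDef.one.smul hs)

/-- With `w = (W + s)⁻¹ v`, positivity of `W` gives `s (w ⬝ w) ≤ w ⬝ v`; expanding `0 ≤ |v - s w|²`
then gives the upper bound. -/
theorem dotProduct_inv_add_smul_one_mem_Icc {n : ℕ} {W : Matrix (Fin n) (Fin n) ℝ}
    (hW : W.PosSemidef) {s : ℝ} (hs : 0 < s) (v : Fin n → ℝ) :
    v ⬝ᵥ ((W + s • (1 : Matrix (Fin n) (Fin n) ℝ))⁻¹ *ᵥ v) ∈ Set.Icc 0 (s⁻¹ * (v ⬝ᵥ v)) := by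
  have hpd := posDef_add_smul_one hW hs
  set M := W + s • (1 : Matrix (Fin n) (Fin n) ℝ) with hM
  have h0 : 0 ≤ v ⬝ᵥ (M⁻¹ *ᵥ v) := by
    simpa using hpd.inv.posSemidef.dotProduct_mulVec_nonneg v
  refine ⟨h0, ?_⟩
  set w := M⁻¹ *ᵥ v with hw
  have hMw : M *ᵥ w = v := by
    rw [hw, mulVec_mulVec, mul_nonsing_inv _ ((Matrix.isUnit_iff_isUnit_det _).1 hpd.isUnit),
      one_mulVec]
  have h1 : s * (w ⬝ᵥ w) ≤ w ⬝ᵥ v := by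
    have h2 : 0 ≤ w ⬝ᵥ (W *ᵥ w) := by
      simpa using hW.dotProduct_mulVec_nonneg w
    have h3 : w ⬝ᵥ v = w ⬝ᵥ (W *ᵥ w) + s * (w ⬝ᵥ w) := by
      conv_lhs => rw [← hMw]
      rw [hM, add_mulVec, dotProduct_add, smul_mulVec, one_mulVec, dotProduct_smul, smul_eq_mul]
    linarith
  have h4 : 0 ≤ (v - s • w) ⬝ᵥ (v - s • w) := by
    simpa using dotProduct_star_self_nonneg (v - s • w)
  simp only [sub_dotProduct, dotProduct_sub, smul_dotProduct, dotProduct_smul, smul_eq_mul,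
    dotProduct_comm v w] at h4 h0 ⊢
  rw [inv_mul_eq_div, le_div_iff₀ hs]
  nlinarith

/-- By the resolvent identity the difference of the inverses has rank at most that of `W' - W`. Its
eigenvalues lie in `[-s⁻¹, s⁻¹]`, since both quadratic forms take values in `[0, s⁻¹]` on unit
vectors, and only the nonzero ones contribute to the trace. -/
theorem abs_trace_inv_sub_le {n : ℕ} {W W' : Matrix (Fin n) (Fin n) ℝ}
    (hW : W.PosSemidef) (hW' : W'.PosSemidef) {s : ℝ} (hs : 0 < s) :
    |((W + s • (1 : Matrix (Fin n) (Fin n) ℝ))⁻¹).trace -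
      ((W' + s • (1 : Matrix (Fin n) (Fin n) ℝ))⁻¹).trace| ≤ (W' - W).rank * s⁻¹ := by
  have hpd := posDef_add_smul_one hW hs
  have hpd' := posDef_add_smul_one hW' hs
  have hb := dotProduct_inv_add_smul_one_mem_Icc hW hs
  have hb' := dotProduct_inv_add_smul_one_mem_Icc hW' hs
  set M := W + s • (1 : Matrix (Fin n) (Fin n) ℝ) with hM
  set M' := W' + s • (1 : Matrix (Fin n) (Fin n) ℝ) with hM'
  have hD : M⁻¹ - M'⁻¹ = M⁻¹ * ((W' - W) * M'⁻¹) := by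
    have : W' - W = M' - M := by simp [hM, hM']
    rw [this, sub_mul, mul_nonsing_inv _ ((Matrix.isUnit_iff_isUnit_det _).1 hpd'.isUnit),
      mul_sub, mul_one, ← mul_assoc,
      nonsing_inv_mul _ ((Matrix.isUnit_iff_isUnit_det _).1 hpd.isUnit), one_mul]
  have hrank : (M⁻¹ - M'⁻¹).rank ≤ (W' - W).rank := by
    rw [hD]
    exact (rank_mul_le_right _ _).trans (rank_mul_le_left _ _)
  have hH : (M⁻¹ - M'⁻¹).IsHermitian := hpd.inv.isHermitian.sub hpd'.inv.isHermitian
  rw [← trace_sub, hH.trace_eq_sum_eigenvalues]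
  have heig : ∀ i, |hH.eigenvalues i| ≤ s⁻¹ := by
    intro i
    set v : Fin n → ℝ := ⇑(hH.eigenvectorBasis i) with hv
    have hvv : v ⬝ᵥ v = 1 := by
      have := hH.eigenvectorBasis.inner_eq_one i
      rw [EuclideanSpace.inner_eq_star_dotProduct, star_trivial] at this
      exact this
    have h1 := congrArg (v ⬝ᵥ ·) (hH.mulVec_eigenvectorBasis i)
    simp only [← hv, sub_mulVec, dotProduct_sub, dotProduct_smul, hvv, smul_eq_mul, mul_one] at h1
    have h2 := hb v
    have h3 := hb' v
    rw [hvv, mul_one] at h2 h3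
    rw [← h1, abs_le]
    constructor <;> linarith [h2.1, h2.2, h3.1, h3.2]
  calc |∑ i, ((hH.eigenvalues i : ℝ) : ℝ)| ≤ ∑ i, |hH.eigenvalues i| :=
        Finset.abs_sum_le_sum_abs _ _
    _ = ∑ i with hH.eigenvalues i ≠ 0, |hH.eigenvalues i| := by
      rw [Finset.sum_filter]
      refine Finset.sum_congr rfl fun i _ => ?_
      by_cases h : hH.eigenvalues i = 0 <;> simp [h]
    _ ≤ ∑ i with hH.eigenvalues i ≠ 0, s⁻¹ := Finset.sum_le_sum fun i _ => heig i
    _ = (M⁻¹ - M'⁻¹).rank * s⁻¹ := by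
      rw [hH.rank_eq_card_non_zero_eigs, Fintype.card_subtype]
      simp
    _ ≤ _ := by gcongr

/-- The Stieltjes sum `∑ᵢ 1 / (λᵢ + s)` of the spectrum of `c⁻¹ X Xᵀ`. -/
noncomputable def stieltjesSum (c s : ℝ) {n m : ℕ} (X : Matrix (Fin n) (Fin m) ℝ) : ℝ :=
  ∑ i, ((wishart_isHermitian c X).eigenvalues i + s)⁻¹

theorem Matrix.rank_add_le_rank_add_rank {n m : ℕ} (A B : Matrix (Fin n) (Fin m) ℝ) :
    (A + B).rank ≤ A.rank + B.rank := by
  rw [Matrix.rank, Matrix.rank, Matrix.rank, Matrix.mulVecLin_add]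
  refine (Submodule.finrank_mono ?_).trans (Submodule.finrank_add_le_finrank_add_finrank _ _)
  rintro _ ⟨v, rfl⟩
  exact Submodule.add_mem_sup ⟨v, rfl⟩ ⟨v, rfl⟩

/-- `X Xᵀ - Y Yᵀ = (X - Y) Yᵀ + X (X - Y)ᵀ` has rank at most 2. The bound does not depend on the
dimensions; it serves both for concentration and for centering. -/
theorem abs_stieltjesSum_sub_le {c s : ℝ} (hc : 0 < c) (hs : 0 < s) {n m : ℕ}
    (X Y : Matrix (Fin n) (Fin m) ℝ) (h : (X - Y).rank ≤ 1) :
    |stieltjesSum c s X - stieltjesSum c s Y| ≤ 2 * s⁻¹ := by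
  rw [stieltjesSum, stieltjesSum, ← trace_inv_add_smul_one (wishart_posSemidef hc X) hs,
    ← trace_inv_add_smul_one (wishart_posSemidef hc Y) hs]
  refine (abs_trace_inv_sub_le (wishart_posSemidef hc X) (wishart_posSemidef hc Y) hs).trans ?_
  have hr : (wishart c Y - wishart c X).rank ≤ 2 := by
    have h1 : wishart c Y - wishart c X =
        (X - Y) * (-(c⁻¹ • Yᵀ)) + (-(c⁻¹ • X)) * (X - Y)ᵀ := by
      simp only [wishart, transpose_sub, Matrix.mul_sub, Matrix.sub_mul, Matrix.mul_neg,
        Matrix.neg_mul, Matrix.mul_smul, Matrix.smul_mul, smul_sub]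
      abel
    rw [h1]
    refine (Matrix.rank_add_le_rank_add_rank _ _).trans ?_
    have h2 := rank_mul_le_left (X - Y) (-(c⁻¹ • Yᵀ))
    have h3 := rank_mul_le_right (-(c⁻¹ • X)) (X - Y)ᵀ
    rw [rank_transpose] at h3
    omega
  gcongr
  exact_mod_cast hr

end

/-! ### The moment problem: determinacy and convergence of moments -/

/-- The moments are the Taylor coefficients of the moment generating function at `0`. Its complex
extension is analytic on the strip `|Re z| < δ`, so the identity theorem carries the equality near
`0` to the imaginary axis, where it is the characteristic function. -/
theorem ext_of_moments_eq {μ ν : Measure ℝ} [IsFiniteMeasure μ] [IsFiniteMeasure ν] {δ : ℝ}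
    (hδ : 0 < δ) (hμ : ∀ t, |t| < δ → Integrable (fun x => Real.exp (t * x)) μ)
    (hν : ∀ t, |t| < δ → Integrable (fun x => Real.exp (t * x)) ν)
    (h : ∀ k : ℕ, ∫ x, x ^ k ∂μ = ∫ x, x ^ k ∂ν) : μ = ν := by
  have key : ∀ ρ : Measure ℝ, (∀ t, |t| < δ → Integrable (fun x => Real.exp (t * x)) ρ) →
      Set.Ioo (-δ) δ ⊆ interior (integrableExpSet id ρ) := fun ρ hρ =>
    interior_maximal (fun t ht => hρ t (abs_lt.2 ht)) isOpen_Ioo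
  have h0 : (0 : ℝ) ∈ Set.Ioo (-δ) δ := ⟨by linarith, hδ⟩
  have hmgf : ∀ᶠ t in 𝓝 (0 : ℝ), mgf id μ t = mgf id ν t := by
    have h1 := (hasFPowerSeriesAt_mgf (key μ hμ h0)).eventually_hasSum
    have h2 := (hasFPowerSeriesAt_mgf (key ν hν h0)).eventually_hasSum
    filter_upwards [h1, h2] with t h1 h2
    simp only [id, zero_mul, Real.exp_zero, mul_one, h, zero_add] at h1 h2
    exact h1.unique h2
  have hU : IsPreconnected {z : ℂ | z.re ∈ Set.Ioo (-δ) δ} :=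
    ((convex_Ioo (-δ) δ).linear_preimage Complex.reLm).isPreconnected
  have heq : Set.EqOn (complexMGF id μ) (complexMGF id ν) {z : ℂ | z.re ∈ Set.Ioo (-δ) δ} := by
    refine AnalyticOnNhd.eqOn_of_preconnected_of_frequently_eq
      (analyticOnNhd_complexMGF.mono fun z hz => key μ hμ hz)
      (analyticOnNhd_complexMGF.mono fun z hz => key ν hν hz) hU (z₀ := ((0 : ℝ) : ℂ))
      (by simpa using h0) ?_
    have ht : Tendsto (fun x : ℝ => (x : ℂ)) (𝓝[≠] 0) (𝓝[≠] ((0 : ℝ) : ℂ)) := by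
      refine tendsto_nhdsWithin_of_tendsto_nhds_of_eventually_within _ ?_ ?_
      · exact (Complex.continuous_ofReal.tendsto 0).mono_left nhdsWithin_le_nhds
      · filter_upwards [self_mem_nhdsWithin] with x hx
        simpa using hx
    refine ht.frequently (Eventually.frequently ?_)
    filter_upwards [hmgf.filter_mono nhdsWithin_le_nhds] with x hx
    simp only [complexMGF_ofReal, hx]
  refine Measure.ext_of_charFun (funext fun t => ?_)
  rw [← complexMGF_id_mul_I, ← complexMGF_id_mul_I]
  exact heq (by simpa using h0)

/-- `μ` lives on `[0, ∞)` and its moments are `M`. -/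
structure HasNonnegMoments (μ : Measure ℝ) (M : ℕ → ℝ) : Prop where
  ae_nonneg : ∀ᵐ x ∂μ, 0 ≤ x
  integrable_pow : ∀ k : ℕ, Integrable (fun x => x ^ k) μ
  integral_pow : ∀ k : ℕ, ∫ x, x ^ k ∂μ = M k

/-- Integrating `cosh (t √x) = ∑ t²ᵏ xᵏ / (2k)!` termwise leaves a geometric series of ratio `C t²`,
and `exp ≤ 2 cosh`. -/
theorem HasNonnegMoments.integrable_exp_sqrt {μ : Measure ℝ} {M : ℕ → ℝ}
    (h : HasNonnegMoments μ M) {K C : ℝ} (hC : 0 ≤ C)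
    (hM : ∀ k, M k ≤ K * C ^ k * (2 * k).factorial) {t : ℝ} (ht : C * t ^ 2 < 1) :
    Integrable (fun x => Real.exp (t * √x)) μ := by
  have hcosh : Integrable (fun x => Real.cosh (t * √x)) μ := by
    refine ⟨by fun_prop, ?_⟩
    rw [hasFiniteIntegral_iff_ofReal (ae_of_all _ fun x => (Real.cosh_pos _).le)]
    have h1 : ∀ᵐ x ∂μ, ENNReal.ofReal (Real.cosh (t * √x)) =
        ∑' k : ℕ, ENNReal.ofReal (t ^ (2 * k) / (2 * k).factorial * x ^ k) := by
      filter_upwards [h.ae_nonneg] with x hx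
      have h2 := Real.hasSum_cosh (t * √x)
      have h3 : ∀ k : ℕ, (t * √x) ^ (2 * k) / ((2 * k).factorial : ℝ) =
          t ^ (2 * k) / (2 * k).factorial * x ^ k := by
        intro k
        rw [mul_pow, pow_mul √x, Real.sq_sqrt hx]
        ring
      simp only [h3] at h2
      rw [← h2.tsum_eq, ENNReal.ofReal_tsum_of_nonneg _ h2.summable]
      intro k
      rw [pow_mul]
      positivity
    rw [lintegral_congr_ae h1, lintegral_tsum (fun k => by fun_prop)]
    have h4 : ∀ k : ℕ, ∫⁻ x, ENNReal.ofReal (t ^ (2 * k) / (2 * k).factorial * x ^ k) ∂μ ≤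
        ENNReal.ofReal (K * (C * t ^ 2) ^ k) := by
      intro k
      rw [← ofReal_integral_eq_lintegral_ofReal ((h.integrable_pow k).const_mul _),
        integral_const_mul, h.integral_pow]
      · refine ENNReal.ofReal_le_ofReal ?_
        have : 0 ≤ t ^ (2 * k) / ((2 * k).factorial : ℝ) := by rw [pow_mul]; positivity
        refine (mul_le_mul_of_nonneg_left (hM k) this).trans (le_of_eq ?_)
        have : ((2 * k).factorial : ℝ) ≠ 0 := by positivity
        field_simp
        ring
      · filter_upwards [h.ae_nonneg] with x hx
        simp only [Pi.zero_apply]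
        rw [pow_mul]
        positivity
    refine (ENNReal.tsum_le_tsum h4).trans_lt ?_
    have hs : Summable fun k : ℕ => K * (C * t ^ 2) ^ k :=
      (summable_geometric_of_lt_one (by positivity) ht).mul_left _
    exact hs.tsum_ofReal_lt_top
  refine (hcosh.const_mul 2).mono' (by fun_prop) (ae_of_all _ fun x => ?_)
  rw [Real.norm_eq_abs, abs_of_pos (Real.exp_pos _), Real.cosh_eq]
  linarith [Real.exp_pos (-(t * √x))]

/-- The image of `μ + μ` under the two square roots. -/
noncomputable def sqrtSymm (μ : Measure ℝ) : Measure ℝ :=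
  μ.map (fun x => √x) + μ.map (fun x => -√x)

/-- Growth `(2k)!` need not give `μ` itself exponential moments, but it gives them to the law of
`±√x`. The symmetrized measure has vanishing odd moments and even moments `2 M`, so it is determined
by `M`; squaring recovers `μ + μ`. -/
theorem HasNonnegMoments.eq {μ ν : Measure ℝ} [IsFiniteMeasure μ] [IsFiniteMeasure ν]
    {M : ℕ → ℝ} (hμ : HasNonnegMoments μ M) (hν : HasNonnegMoments ν M) {K C : ℝ} (hC : 0 ≤ C)
    (hM : ∀ k, M k ≤ K * C ^ k * (2 * k).factorial) : μ = ν := by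
  have hs : Measurable fun x : ℝ => √x := by fun_prop
  have hs' : Measurable fun x : ℝ => -√x := by fun_prop
  have fin (ρ : Measure ℝ) [IsFiniteMeasure ρ] : IsFiniteMeasure (sqrtSymm ρ) := by
    rw [sqrtSymm]; infer_instance
  -- Since `δ ≤ 1`, `|t| < δ` gives `t² ≤ δ`, hence `C t² ≤ C / (C + 1) < 1`.
  set δ : ℝ := 1 / (C + 1) with hδ
  have hδ0 : 0 < δ := by positivity
  have hlt : ∀ t : ℝ, |t| < δ → C * t ^ 2 < 1 := by
    intro t ht
    have h1 : δ ≤ 1 := by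
      rw [hδ, div_le_one (by linarith)]
      linarith
    have h2 : t ^ 2 ≤ δ := by
      rw [← sq_abs]
      nlinarith [abs_nonneg t]
    have h3 : (C + 1) * δ = 1 := by rw [hδ]; field_simp
    nlinarith
  have hint : ∀ (ρ : Measure ℝ), HasNonnegMoments ρ M → ∀ t, |t| < δ →
      Integrable (fun x => Real.exp (t * x)) (sqrtSymm ρ) := by
    intro ρ hρ t ht
    rw [sqrtSymm, integrable_add_measure]
    constructor
    · rw [integrable_map_measure (by fun_prop) (by fun_prop)]
      exact hρ.integrable_exp_sqrt hC hM (hlt t ht)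
    · rw [integrable_map_measure (by fun_prop) (by fun_prop)]
      have := hρ.integrable_exp_sqrt hC hM (t := -t) (by simpa using hlt t ht)
      simpa [Function.comp_def] using this
  have hmom : ∀ (ρ : Measure ℝ) [IsFiniteMeasure ρ], HasNonnegMoments ρ M → ∀ k : ℕ,
      ∫ x, x ^ k ∂(sqrtSymm ρ) = if Even k then 2 * M (k / 2) else 0 := by
    intro ρ _ hρ k
    have hI : Integrable (fun x => √x ^ k) ρ := by
      refine ((integrable_const 1).add (hρ.integrable_pow k)).mono' (by fun_prop) ?_
      filter_upwards [hρ.ae_nonneg] with x hx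
      rw [Real.norm_eq_abs, abs_of_nonneg (by positivity)]
      rcases le_total x 1 with h | h
      · have : √x ^ k ≤ 1 := pow_le_one₀ (by positivity) (Real.sqrt_le_one.2 h)
        have : 0 ≤ x ^ k := by positivity
        simp only [Pi.add_apply]
        linarith
      · have : √x ^ k ≤ x ^ k :=
          pow_le_pow_left₀ (by positivity) (Real.sqrt_le_iff.2 ⟨hx, by nlinarith⟩) k
        simp only [Pi.add_apply]
        linarith
    have hI' : Integrable (fun x => (-√x) ^ k) ρ := by
      refine (hI.const_mul ((-1) ^ k)).congr (ae_of_all _ fun x => ?_)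
      simp only
      rw [neg_pow √x]
    rw [sqrtSymm, integral_add_measure, integral_map (by fun_prop) (by fun_prop),
      integral_map (by fun_prop) (by fun_prop)]
    · split_ifs with hk
      · obtain ⟨j, rfl⟩ := hk
        have e1 : ∫ x, √x ^ (j + j) ∂ρ = M j := by
          rw [← hρ.integral_pow]
          refine integral_congr_ae ?_
          filter_upwards [hρ.ae_nonneg] with x hx
          rw [← two_mul, pow_mul, Real.sq_sqrt hx]
        have e2 : (j + j) / 2 = j := by omega
        simp only [(Even.add_self j).neg_pow, e1, e2]
        ring
      · simp only [(Nat.not_even_iff_odd.1 hk).neg_pow, integral_neg]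
        ring
    · rw [integrable_map_measure (by fun_prop) (by fun_prop)]
      exact hI
    · rw [integrable_map_measure (by fun_prop) (by fun_prop)]
      exact hI'
  have hρ : sqrtSymm μ = sqrtSymm ν := by
    have := fin μ
    have := fin ν
    refine ext_of_moments_eq hδ0 (hint μ hμ) (hint ν hν) fun k => ?_
    rw [hmom μ hμ, hmom ν hν]
  have hback : ∀ ρ : Measure ℝ, HasNonnegMoments ρ M →
      (sqrtSymm ρ).map (fun x => x ^ 2) = ρ + ρ := by
    intro ρ hρ
    rw [sqrtSymm, Measure.map_add _ _ (by fun_prop), Measure.map_map (by fun_prop) hs,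
      Measure.map_map (by fun_prop) hs']
    have e1 : ρ.map ((fun x : ℝ => x ^ 2) ∘ fun x => √x) = ρ := by
      conv_rhs => rw [← Measure.map_id (μ := ρ)]
      refine Measure.map_congr ?_
      filter_upwards [hρ.ae_nonneg] with x hx
      simp [Real.sq_sqrt hx]
    have e2 : ρ.map ((fun x : ℝ => x ^ 2) ∘ fun x => -√x) = ρ := by
      conv_rhs => rw [← Measure.map_id (μ := ρ)]
      refine Measure.map_congr ?_
      filter_upwards [hρ.ae_nonneg] with x hx
      simp [Real.sq_sqrt hx]
    rw [e1, e2]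
  have hadd : μ + μ = ν + ν := by rw [← hback μ hμ, ← hback ν hν, hρ]
  ext s _
  have h1 := congrArg (fun ρ : Measure ℝ => ρ s) hadd
  simp only [Measure.add_apply, ← two_mul] at h1
  exact (ENNReal.mul_right_inj (by simp) (by simp)).1 h1

/-- The truncated power `min (|x| ^ k) R`. -/
noncomputable def truncPow (k R : ℕ) : ℝ →ᵇ ℝ :=
  BoundedContinuousFunction.ofNormedAddCommGroup (fun x => min (|x| ^ k) R) (by fun_prop) R
    fun x => by
      rw [Real.norm_eq_abs, abs_of_nonneg (by positivity)]
      exact min_le_right _ _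

theorem truncPow_apply (k R : ℕ) (x : ℝ) : truncPow k R x = min (|x| ^ k) R := rfl

/-- The negative part truncated at `1`. -/
noncomputable def truncNeg : ℝ →ᵇ ℝ :=
  BoundedContinuousFunction.ofNormedAddCommGroup (fun x => max 0 (min 1 (-x))) (by fun_prop) 1
    fun x => by
      rw [Real.norm_eq_abs, abs_of_nonneg (by positivity)]
      simp

/-- Powers are unbounded, so weak convergence is applied to truncations. The truncation error is
uniformly small because `xᵏ ≤ min (xᵏ) R + x²ᵏ / R` and the moments of order `2k` converge. -/
theorem HasNonnegMoments.of_tendsto {ι : Type*} {F : Filter ι} [F.NeBot]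
    {ν : ι → ProbabilityMeasure ℝ} {μ : ProbabilityMeasure ℝ} {M : ℕ → ℝ}
    (hμ : Tendsto ν F (𝓝 μ)) (h0 : ∀ i, ∀ᵐ x ∂(ν i : Measure ℝ), 0 ≤ x)
    (hint : ∀ i (k : ℕ), Integrable (fun x => x ^ k) (ν i : Measure ℝ))
    (hM : ∀ k : ℕ, Tendsto (fun i => ∫ x, x ^ k ∂(ν i : Measure ℝ)) F (𝓝 (M k))) :
    HasNonnegMoments μ M := by
  rw [ProbabilityMeasure.tendsto_iff_forall_integral_tendsto] at hμ
  have hnn : ∀ᵐ x ∂(μ : Measure ℝ), 0 ≤ x := by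
    have h1 : ∀ i, ∫ x, truncNeg x ∂(ν i : Measure ℝ) = 0 := by
      intro i
      rw [integral_eq_zero_iff_of_nonneg_ae]
      · filter_upwards [h0 i] with x hx
        change max 0 (min 1 (-x)) = 0
        rw [max_eq_left]
        exact (min_le_right _ _).trans (by linarith)
      · exact ae_of_all _ fun x => le_max_left _ _
      · exact truncNeg.integrable _
    have h2 := hμ truncNeg
    simp only [h1] at h2
    have h3 := tendsto_nhds_unique tendsto_const_nhds h2
    have h4 := (integral_eq_zero_iff_of_nonneg_ae (ae_of_all _ fun x => le_max_left _ _)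
      (truncNeg.integrable (μ : Measure ℝ))).1 h3.symm
    filter_upwards [h4] with x hx
    change max 0 (min 1 (-x)) = 0 at hx
    by_contra hneg
    have : 0 < min 1 (-x) := lt_min one_pos (by linarith)
    have := le_max_right 0 (min 1 (-x))
    linarith
  have hle : ∀ k R : ℕ, ∫ x, truncPow k R x ∂(μ : Measure ℝ) ≤ M k := by
    intro k R
    refine le_of_tendsto_of_tendsto' (hμ (truncPow k R)) (hM k) fun i => ?_
    refine integral_mono_ae ((truncPow k R).integrable _) (hint i k) ?_
    filter_upwards [h0 i] with x hx
    rw [truncPow_apply, abs_of_nonneg hx]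
    exact min_le_left _ _
  have hge : ∀ k R : ℕ, 0 < R →
      M k ≤ ∫ x, truncPow k R x ∂(μ : Measure ℝ) + M (2 * k) / R := by
    intro k R hR
    have hR' : (0 : ℝ) < R := by exact_mod_cast hR
    refine le_of_tendsto_of_tendsto' (hM k)
      ((hμ (truncPow k R)).add ((hM (2 * k)).div_const (R : ℝ))) fun i => ?_
    rw [← integral_div, ← integral_add ((truncPow k R).integrable _) ((hint i (2 * k)).div_const _)]
    refine integral_mono_ae (hint i k)
      (((truncPow k R).integrable _).add ((hint i (2 * k)).div_const _)) ?_
    filter_upwards [h0 i] with x hx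
    simp only [truncPow_apply, abs_of_nonneg hx]
    have hp : 0 ≤ x ^ k := by positivity
    rcases le_total (x ^ k) R with h | h
    · rw [min_eq_left h]
      have : 0 ≤ x ^ (2 * k) / R := by positivity
      linarith
    · rw [min_eq_right h]
      have : x ^ k ≤ x ^ (2 * k) / R := by
        rw [le_div_iff₀ hR', two_mul, pow_add]
        exact mul_le_mul_of_nonneg_left h hp
      linarith
  have hM0 : ∀ k, 0 ≤ M k := fun k => by
    have := hle k 0
    refine le_trans (integral_nonneg fun x => ?_) this
    rw [truncPow_apply]
    positivity
  have hlin : ∀ k : ℕ, ∫⁻ x, ENNReal.ofReal (|x| ^ k) ∂(μ : Measure ℝ) ≤ ENNReal.ofReal (M k) := by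
    intro k
    have hsup : Tendsto (fun R : ℕ => ∫⁻ x, ENNReal.ofReal (truncPow k R x) ∂(μ : Measure ℝ)) atTop
        (𝓝 (∫⁻ x, ENNReal.ofReal (|x| ^ k) ∂(μ : Measure ℝ))) := by
      refine lintegral_tendsto_of_tendsto_of_monotone (fun R => ?_) (ae_of_all _ fun x => ?_)
        (ae_of_all _ fun x => ?_)
      · exact ((truncPow k R).continuous.measurable.ennreal_ofReal).aemeasurable
      · intro R R' hRR
        refine ENNReal.ofReal_le_ofReal ?_
        rw [truncPow_apply, truncPow_apply]
        gcongr
      · refine tendsto_const_nhds.congr' ?_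
        obtain ⟨N, hN⟩ := exists_nat_ge (|x| ^ k)
        filter_upwards [eventually_ge_atTop N] with R hR
        rw [truncPow_apply, min_eq_left]
        exact hN.trans (by exact_mod_cast hR)
    refine le_of_tendsto' hsup fun R => ?_
    rw [← ofReal_integral_eq_lintegral_ofReal ((truncPow k R).integrable _)]
    · exact ENNReal.ofReal_le_ofReal (hle k R)
    · refine ae_of_all _ fun x => ?_
      rw [truncPow_apply, Pi.zero_apply]
      positivity
  have hInt : ∀ k : ℕ, Integrable (fun x => x ^ k) (μ : Measure ℝ) := by
    intro k
    refine ⟨by fun_prop, ?_⟩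
    rw [hasFiniteIntegral_iff_norm]
    simp only [norm_pow, Real.norm_eq_abs]
    exact (hlin k).trans_lt ENNReal.ofReal_lt_top
  refine ⟨hnn, hInt, fun k => le_antisymm ?_ ?_⟩
  · have h1 : ∫ x, x ^ k ∂(μ : Measure ℝ) = ∫ x, |x| ^ k ∂(μ : Measure ℝ) := by
      refine integral_congr_ae ?_
      filter_upwards [hnn] with x hx
      rw [abs_of_nonneg hx]
    rw [h1, integral_eq_lintegral_of_nonneg_ae (ae_of_all _ fun x => by positivity) (by fun_prop)]
    exact ENNReal.toReal_le_of_le_ofReal (hM0 k) (hlin k)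
  · have h2 : Tendsto (fun R : ℕ => ∫ x, x ^ k ∂(μ : Measure ℝ) + M (2 * k) / R) atTop
        (𝓝 (∫ x, x ^ k ∂(μ : Measure ℝ) + 0)) :=
      tendsto_const_nhds.add (tendsto_const_nhds.div_atTop tendsto_natCast_atTop_atTop)
    rw [add_zero] at h2
    refine ge_of_tendsto h2 ?_
    filter_upwards [eventually_gt_atTop 0] with R hR
    refine (hge k R hR).trans ?_
    refine add_le_add_left (integral_mono_ae ((truncPow k R).integrable _) (hInt k) ?_) _
    filter_upwards [hnn] with x hx
    rw [truncPow_apply, abs_of_nonneg hx]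
    exact min_le_left _ _

theorem isTightMeasureSet_range_of_integral_le {ν : ℕ → ProbabilityMeasure ℝ} {B : ℝ}
    (h0 : ∀ i, ∀ᵐ x ∂(ν i : Measure ℝ), 0 ≤ x)
    (hint : ∀ i, Integrable (fun x => x) (ν i : Measure ℝ))
    (hB : ∀ i, ∫ x, x ∂(ν i : Measure ℝ) ≤ B) :
    IsTightMeasureSet {((μ : ProbabilityMeasure ℝ) : Measure ℝ) | μ ∈ Set.range ν} := by
  have hB0 : 0 ≤ B := (integral_nonneg_of_ae (h0 0)).trans (hB 0)
  rw [isTightMeasureSet_iff_exists_isCompact_measure_compl_le]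
  intro ε hε
  obtain ⟨R, hR0, hR⟩ : ∃ R : ℝ, 0 < R ∧ ENNReal.ofReal (B / R) ≤ ε := by
    by_cases hεt : ε = ⊤
    · exact ⟨1, one_pos, by simp [hεt]⟩
    have he : 0 < ε.toReal := ENNReal.toReal_pos hε.ne' hεt
    refine ⟨(B + 1) / ε.toReal, by positivity, ?_⟩
    rw [← ENNReal.ofReal_toReal hεt]
    refine ENNReal.ofReal_le_ofReal ?_
    rw [ENNReal.toReal_ofReal he.le, div_div_eq_mul_div, div_le_iff₀ (by positivity)]
    nlinarith
  refine ⟨Set.Icc 0 R, isCompact_Icc, ?_⟩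
  rintro _ ⟨_, ⟨i, rfl⟩, rfl⟩
  have h1 := mul_meas_ge_le_integral_of_nonneg (h0 i) (hint i) R
  calc (ν i : Measure ℝ) (Set.Icc 0 R)ᶜ ≤ (ν i : Measure ℝ) {x | R ≤ x} := by
        refine measure_mono_ae ?_
        filter_upwards [h0 i] with x hx hx'
        change R ≤ x
        by_contra h
        exact hx' ⟨hx, by linarith⟩
    _ = ENNReal.ofReal ((ν i : Measure ℝ).real {x | R ≤ x}) := by
        rw [measureReal_def, ENNReal.ofReal_toReal (measure_ne_top _ _)]
    _ ≤ ENNReal.ofReal (B / R) := by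
        refine ENNReal.ofReal_le_ofReal ?_
        rw [le_div_iff₀ hR0, mul_comm]
        exact h1.trans (hB i)
    _ ≤ ε := hR

/-- The first moments are bounded, so the sequence is tight and converges along every ultrafilter
finer than `atTop`. All these limits have the moments `M`, so determinacy makes them equal. -/
theorem exists_tendsto_of_moments {ν : ℕ → ProbabilityMeasure ℝ} {M : ℕ → ℝ}
    (h0 : ∀ i, ∀ᵐ x ∂(ν i : Measure ℝ), 0 ≤ x)
    (hint : ∀ i (k : ℕ), Integrable (fun x => x ^ k) (ν i : Measure ℝ))
    (hM : ∀ k : ℕ, Tendsto (fun i => ∫ x, x ^ k ∂(ν i : Measure ℝ)) atTop (𝓝 (M k)))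
    {K C : ℝ} (hC : 0 ≤ C) (hMle : ∀ k, M k ≤ K * C ^ k * (2 * k).factorial) :
    ∃ μ : ProbabilityMeasure ℝ, HasNonnegMoments μ M ∧ Tendsto ν atTop (𝓝 μ) := by
  obtain ⟨B, hB⟩ := (hM 1).bddAbove_range
  have htight : IsTightMeasureSet {((μ : ProbabilityMeasure ℝ) : Measure ℝ) | μ ∈ Set.range ν} :=
    isTightMeasureSet_range_of_integral_le h0 (fun i => by simpa using hint i 1)
      (fun i => by simpa using hB ⟨i, rfl⟩)
  have hcomp := isCompact_closure_of_isTightMeasureSet htight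
  have hex : ∀ U : Ultrafilter ℕ, (U : Filter ℕ) ≤ atTop →
      ∃ μ : ProbabilityMeasure ℝ, HasNonnegMoments μ M ∧ Tendsto ν U (𝓝 μ) := by
    intro U hU
    obtain ⟨μ, -, hμ⟩ := hcomp.ultrafilter_le_nhds (U.map ν)
      (.trans (by simp) (monotone_principal subset_closure))
    exact ⟨μ, HasNonnegMoments.of_tendsto hμ h0 hint fun k => (hM k).mono_left hU, hμ⟩
  obtain ⟨μ, hμ, -⟩ := hex (Ultrafilter.of atTop) (Ultrafilter.of_le _)
  refine ⟨μ, hμ, (tendsto_iff_ultrafilter _ _ _).2 fun U hU => ?_⟩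
  obtain ⟨μ', hμ', hlim⟩ := hex U hU
  have heq : (μ' : Measure ℝ) = μ := hμ'.eq hμ hC hMle
  have : μ' = μ := Subtype.ext heq
  rwa [this] at hlim

/-! ### From Stieltjes transforms to weak convergence -/

theorem Integrable.of_bdd_nonneg {ρ : Measure ℝ} [IsFiniteMeasure ρ] (h0 : ∀ᵐ x ∂ρ, 0 ≤ x)
    {g : ℝ → ℝ} (hg : Measurable g) {C : ℝ} (hC : ∀ x, 0 ≤ x → |g x| ≤ C) : Integrable g ρ := by
  refine (integrable_const C).mono' hg.aestronglyMeasurable ?_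
  filter_upwards [h0] with x hx
  exact hC x hx

/-- The functions, bounded on `[0, ∞)`, whose integrals against `ν` converge to the integral
against `μ`. -/
structure IntegralsConverge (ν : ℕ → Measure ℝ) (μ : Measure ℝ) (g : ℝ → ℝ) : Prop where
  measurable : Measurable g
  bdd : ∃ C, ∀ x, 0 ≤ x → |g x| ≤ C
  tendsto : Tendsto (fun n => ∫ x, g x ∂(ν n)) atTop (𝓝 (∫ x, g x ∂μ))

theorem IntegralsConverge.const_mul {ν : ℕ → Measure ℝ} {μ : Measure ℝ} {f : ℝ → ℝ}
    (hf : IntegralsConverge ν μ f) (a : ℝ) : IntegralsConverge ν μ (fun x => a * f x) := by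
  obtain ⟨C, hC⟩ := hf.bdd
  refine ⟨hf.measurable.const_mul a, ⟨|a| * C, fun x hx => ?_⟩, ?_⟩
  · rw [abs_mul]
    exact mul_le_mul_of_nonneg_left (hC x hx) (abs_nonneg a)
  · simp only [integral_const_mul]
    exact hf.tendsto.const_mul a

section

variable {ν : ℕ → Measure ℝ} {μ : Measure ℝ} [∀ n, IsProbabilityMeasure (ν n)]
  [IsProbabilityMeasure μ]

theorem IntegralsConverge.add (hν : ∀ n, ∀ᵐ x ∂(ν n), 0 ≤ x) (hμ : ∀ᵐ x ∂μ, 0 ≤ x)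
    {f g : ℝ → ℝ} (hf : IntegralsConverge ν μ f) (hg : IntegralsConverge ν μ g) :
    IntegralsConverge ν μ (fun x => f x + g x) := by
  obtain ⟨C, hC⟩ := hf.bdd
  obtain ⟨D, hD⟩ := hg.bdd
  refine ⟨hf.measurable.add hg.measurable, ⟨C + D, fun x hx =>
    (abs_add_le _ _).trans (add_le_add (hC x hx) (hD x hx))⟩, ?_⟩
  have h1 : ∀ ρ : Measure ℝ, IsFiniteMeasure ρ → (∀ᵐ x ∂ρ, 0 ≤ x) →
      ∫ x, f x + g x ∂ρ = ∫ x, f x ∂ρ + ∫ x, g x ∂ρ := fun ρ _ h =>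
    integral_add (Integrable.of_bdd_nonneg h hf.measurable hC)
      (Integrable.of_bdd_nonneg h hg.measurable hD)
  rw [h1 μ inferInstance hμ]
  simp only [fun n => h1 (ν n) inferInstance (hν n)]
  exact hf.tendsto.add hg.tendsto

theorem IntegralsConverge.const (a : ℝ) : IntegralsConverge ν μ (fun _ => a) := by
  refine ⟨measurable_const, ⟨|a|, fun _ _ => le_rfl⟩, ?_⟩
  simp

theorem IntegralsConverge.sum (hν : ∀ n, ∀ᵐ x ∂(ν n), 0 ≤ x) (hμ : ∀ᵐ x ∂μ, 0 ≤ x)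
    {ι : Type*} (t : Finset ι) {f : ι → ℝ → ℝ} (hf : ∀ i ∈ t, IntegralsConverge ν μ (f i)) :
    IntegralsConverge ν μ (fun x => ∑ i ∈ t, f i x) := by
  classical
  induction t using Finset.induction_on with
  | empty => simpa using IntegralsConverge.const 0
  | insert i t hi ih =>
    simp only [Finset.sum_insert hi]
    exact (hf i (by simp)).add hν hμ (ih fun j hj => hf j (by simp [hj]))

theorem IntegralsConverge.of_approx (hν : ∀ n, ∀ᵐ x ∂(ν n), 0 ≤ x) (hμ : ∀ᵐ x ∂μ, 0 ≤ x)
    {f : ℝ → ℝ} (hf : Measurable f)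
    (h : ∀ ε > 0, ∃ g, IntegralsConverge ν μ g ∧ ∀ x, 0 ≤ x → |g x - f x| ≤ ε) :
    IntegralsConverge ν μ f := by
  have hbdd : ∃ C, ∀ x, 0 ≤ x → |f x| ≤ C := by
    obtain ⟨g, hg, hgf⟩ := h 1 one_pos
    obtain ⟨C, hC⟩ := hg.bdd
    refine ⟨C + 1, fun x hx => ?_⟩
    have h1 := abs_le.1 (hgf x hx)
    have h2 := abs_le.1 (hC x hx)
    rw [abs_le]
    constructor <;> linarith [h1.1, h1.2, h2.1, h2.2]
  refine ⟨hf, hbdd, ?_⟩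
  obtain ⟨C, hC⟩ := hbdd
  rw [Metric.tendsto_atTop]
  intro ε hε
  obtain ⟨g, hg, hgf⟩ := h (ε / 4) (by positivity)
  obtain ⟨D, hD⟩ := hg.bdd
  obtain ⟨N, hN⟩ := Metric.tendsto_atTop.1 hg.tendsto (ε / 4) (by positivity)
  have h1 : ∀ ρ : Measure ℝ, IsProbabilityMeasure ρ → (∀ᵐ x ∂ρ, 0 ≤ x) →
      |∫ x, g x ∂ρ - ∫ x, f x ∂ρ| ≤ ε / 4 := by
    intro ρ _ hρ
    rw [← integral_sub (Integrable.of_bdd_nonneg hρ hg.measurable hD)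
      (Integrable.of_bdd_nonneg hρ hf hC)]
    have h2 : ∀ᵐ x ∂ρ, ‖g x - f x‖ ≤ ε / 4 := by
      filter_upwards [hρ] with x hx
      exact hgf x hx
    simpa using norm_integral_le_of_norm_le_const h2
  refine ⟨N, fun n hn => ?_⟩
  have h2 := abs_le.1 (h1 μ inferInstance hμ)
  have h3 := abs_le.1 (h1 (ν n) inferInstance (hν n))
  have h4 := hN n hn
  rw [Real.dist_eq, abs_lt] at h4 ⊢
  constructor <;> linarith [h2.1, h2.2, h3.1, h3.2, h4.1, h4.2]

/-- With `u = (x + 1)⁻¹`, one has `(x + 1 + e)⁻¹ = u / (1 + e u) = ∑ (-e)ʲ uʲ⁺¹` formally. Knowing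
the lower powers, the next one is read off as a difference quotient with `e = 1 / (q + 1)` small. -/
theorem IntegralsConverge.pow_of_stieltjes (hν : ∀ n, ∀ᵐ x ∂(ν n), 0 ≤ x)
    (hμ : ∀ᵐ x ∂μ, 0 ≤ x)
    (h : ∀ q : ℕ, IntegralsConverge ν μ (fun x => (x + (1 + 1 / (q + 1 : ℝ)))⁻¹)) (k : ℕ) :
    IntegralsConverge ν μ (fun x => ((x + 1)⁻¹) ^ k) := by
  induction k using Nat.strong_induction_on with
  | _ k ih =>
  rcases k with _ | k
  · simpa using IntegralsConverge.const 1
  refine IntegralsConverge.of_approx hν hμ (by fun_prop) fun ε hε => ?_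
  obtain ⟨q, hq⟩ := exists_nat_one_div_lt hε
  set e : ℝ := 1 / (q + 1 : ℝ) with he
  have he0 : 0 < e := by positivity
  -- Subtracting the first `k` terms of the geometric series and dividing by `(-e)ᵏ` leaves exactly
  -- `uᵏ⁺¹ / (1 + e u)`, which is within `e` of `uᵏ⁺¹`.
  refine ⟨fun x => ((-e) ^ k)⁻¹ * ((x + (1 + e))⁻¹ +
    ∑ j ∈ Finset.range k, (-((-e) ^ j)) * ((x + 1)⁻¹) ^ (j + 1)), ?_, fun x hx => ?_⟩
  · refine ((h q).add hν hμ (IntegralsConverge.sum hν hμ _ fun j hj => ?_)).const_mul _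
    exact (ih (j + 1) (by have := Finset.mem_range.1 hj; omega)).const_mul _
  · set u := (x + 1)⁻¹ with hu
    have hx1 : 0 < x + 1 := by linarith
    have hu0 : 0 < u := inv_pos.2 hx1
    have hu1 : u ≤ 1 := inv_le_one_of_one_le₀ (by linarith)
    have h1 : (x + (1 + e))⁻¹ = u / (1 + e * u) := by
      rw [hu]
      field_simp
      ring
    have hk : ((-e) ^ k) ≠ 0 := pow_ne_zero _ (by linarith [he0] : (-e) ≠ 0)
    have hd : 0 < 1 + e * u := by positivity
    have h2 : ∑ j ∈ Finset.range k, (-((-e) ^ j)) * u ^ (j + 1) =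
        -(u * ((1 - (-e * u) ^ k) / (1 + e * u))) := by
      have h3 := mul_neg_geom_sum (-e * u) k
      have h4 : ∑ j ∈ Finset.range k, (-e * u) ^ j = (1 - (-e * u) ^ k) / (1 + e * u) := by
        rw [eq_div_iff hd.ne', ← h3]
        ring
      rw [← h4, Finset.mul_sum, ← Finset.sum_neg_distrib]
      refine Finset.sum_congr rfl fun j _ => ?_
      rw [mul_pow]
      ring
    have h5 : ((-e) ^ k)⁻¹ * ((x + (1 + e))⁻¹ +
        ∑ j ∈ Finset.range k, (-((-e) ^ j)) * u ^ (j + 1)) - u ^ (k + 1) =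
        -(e * u * (u ^ (k + 1) / (1 + e * u))) := by
      rw [h1, h2, mul_pow]
      field_simp
      ring
    rw [h5, abs_neg, abs_of_nonneg (by positivity)]
    have h6 : u ^ (k + 1) / (1 + e * u) ≤ 1 := by
      rw [div_le_one hd]
      have : u ^ (k + 1) ≤ 1 := pow_le_one₀ hu0.le hu1
      nlinarith [mul_pos he0 hu0]
    have h7 : 0 ≤ u ^ (k + 1) / (1 + e * u) := by positivity
    calc e * u * (u ^ (k + 1) / (1 + e * u)) ≤ e * 1 * 1 := by gcongr
      _ ≤ ε := by linarith

/-- Weierstrass approximation on `[0, 1]`, where `(x + 1)⁻¹` takes its values for `x ≥ 0`. -/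
theorem IntegralsConverge.comp_of_stieltjes (hν : ∀ n, ∀ᵐ x ∂(ν n), 0 ≤ x)
    (hμ : ∀ᵐ x ∂μ, 0 ≤ x)
    (h : ∀ q : ℕ, IntegralsConverge ν μ (fun x => (x + (1 + 1 / (q + 1 : ℝ)))⁻¹))
    {φ : ℝ → ℝ} (hφ : Continuous φ) : IntegralsConverge ν μ (fun x => φ ((x + 1)⁻¹)) := by
  refine IntegralsConverge.of_approx hν hμ (hφ.measurable.comp (by fun_prop)) fun ε hε => ?_
  obtain ⟨p, hp⟩ := exists_polynomial_near_of_continuousOn 0 1 φ hφ.continuousOn ε hε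
  refine ⟨fun x => p.eval ((x + 1)⁻¹), ?_, fun x hx => (hp _ ⟨?_, ?_⟩).le⟩
  · simp only [Polynomial.eval_eq_sum_range]
    exact IntegralsConverge.sum hν hμ _ fun j _ =>
      (IntegralsConverge.pow_of_stieltjes hν hμ h j).const_mul _
  · positivity
  · exact inv_le_one_of_one_le₀ (by linarith)

/-- A piecewise linear cutoff: `1` at `0`, `0` from `K` on. -/
noncomputable def cutoff (K x : ℝ) : ℝ := max 0 (1 - |x| / K)

theorem IntegralsConverge.mul_cutoff (hν : ∀ n, ∀ᵐ x ∂(ν n), 0 ≤ x)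
    (hμ : ∀ᵐ x ∂μ, 0 ≤ x)
    (h : ∀ q : ℕ, IntegralsConverge ν μ (fun x => (x + (1 + 1 / (q + 1 : ℝ)))⁻¹))
    {f : ℝ → ℝ} (hf : Continuous f) {K : ℝ} (hK : 0 < K) :
    IntegralsConverge ν μ (fun x => f x * cutoff K x) := by
  set G : ℝ → ℝ := fun x => f x * cutoff K x with hG
  have hGc : Continuous G := by
    simp only [hG, cutoff]
    fun_prop
  -- The variable change `y = (x + 1)⁻¹` is inverted by `y⁻¹ - 1`; the maximum avoids the
  -- singularity at `0` and costs nothing, because `G` vanishes on `[K, ∞)`.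
  have hφ : Continuous fun y : ℝ => G ((max y (K + 1)⁻¹)⁻¹ - 1) := by
    refine hGc.comp (Continuous.sub (Continuous.inv₀ (by fun_prop) fun y => ?_) continuous_const)
    have : 0 < max y (K + 1)⁻¹ := lt_max_of_lt_right (by positivity)
    exact this.ne'
  refine IntegralsConverge.of_approx hν hμ hGc.measurable fun ε hε =>
    ⟨_, IntegralsConverge.comp_of_stieltjes hν hμ h hφ, fun x hx => ?_⟩
  have : G ((max (x + 1)⁻¹ (K + 1)⁻¹)⁻¹ - 1) = G x := by
    rcases le_total x K with hxK | hxK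
    · rw [max_eq_left (inv_anti₀ (by linarith) (by linarith))]
      simp
    · rw [max_eq_right (inv_anti₀ (by linarith) (by linarith))]
      have h1 : cutoff K K = 0 := by simp [cutoff, abs_of_pos hK, div_self hK.ne']
      have h2 : cutoff K x = 0 := by
        rw [cutoff, abs_of_nonneg hx, max_eq_left]
        rw [sub_nonpos, one_le_div hK]
        exact hxK
      simp [hG, h1, h2]
  rw [this, sub_self, abs_zero]
  exact hε.le

/-- Integrals of truncated functions converge. Applied to the cutoff itself, this shows that no mass
escapes: a cutoff that captures most of `μ` eventually captures most of `ν n`, so truncating `f`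
costs little. -/
theorem weaklyConverges_of_stieltjes (hν : ∀ n, ∀ᵐ x ∂(ν n), 0 ≤ x)
    (hμ : ∀ᵐ x ∂μ, 0 ≤ x)
    (h : ∀ q : ℕ, Tendsto (fun n => ∫ x, (x + (1 + 1 / (q + 1 : ℝ)))⁻¹ ∂(ν n)) atTop
      (𝓝 (∫ x, (x + (1 + 1 / (q + 1 : ℝ)))⁻¹ ∂μ))) : WeaklyConverges ν μ := by
  have h' : ∀ q : ℕ, IntegralsConverge ν μ (fun x => (x + (1 + 1 / (q + 1 : ℝ)))⁻¹) := by
    refine fun q => ⟨by fun_prop, ⟨1, fun x hx => ?_⟩, h q⟩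
    have : 0 < 1 / (q + 1 : ℝ) := by positivity
    rw [abs_of_nonneg (by positivity)]
    exact inv_le_one_of_one_le₀ (by linarith)
  have hcut : ∀ K : ℝ, 0 < K → ∀ x, 0 ≤ cutoff K x ∧ cutoff K x ≤ 1 := fun K hK x =>
    ⟨le_max_left _ _, max_le zero_le_one (by
      have : 0 ≤ |x| / K := by positivity
      linarith)⟩
  have hcutm : ∀ K : ℝ, Measurable (cutoff K) := fun K => by
    have : Continuous (cutoff K) := by unfold cutoff; fun_prop
    exact this.measurable
  have hone : Tendsto (fun K : ℕ => ∫ x, cutoff (K + 1 : ℝ) x ∂μ) atTop (𝓝 1) := by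
    have : Tendsto (fun K : ℕ => ∫ x, cutoff (K + 1 : ℝ) x ∂μ) atTop (𝓝 (∫ _, (1 : ℝ) ∂μ)) := by
      refine tendsto_integral_of_dominated_convergence (fun _ => 1)
        (fun K => (hcutm _).aestronglyMeasurable) (integrable_const _)
        (fun K => ae_of_all _ fun x => ?_) (ae_of_all _ fun x => ?_)
      · have := hcut (K + 1) (by positivity) x
        rw [Real.norm_eq_abs, abs_of_nonneg this.1]
        exact this.2
      · have h1 : Tendsto (fun K : ℕ => max 0 (1 - |x| / (K + 1 : ℝ))) atTop
            (𝓝 (max 0 (1 - 0))) := by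
          refine tendsto_const_nhds.max (tendsto_const_nhds.sub ?_)
          exact tendsto_const_nhds.div_atTop
            (tendsto_atTop_add_const_right _ _ tendsto_natCast_atTop_atTop)
        simpa [cutoff] using h1
    simpa using this
  intro f
  set B := ‖f‖ + 1 with hB
  have hB0 : 0 < B := by positivity
  have hfB : ∀ x, |f x| ≤ B := fun x => by
    have := f.norm_coe_le_norm x
    rw [Real.norm_eq_abs] at this
    linarith
  rw [Metric.tendsto_atTop]
  intro ε hε
  obtain ⟨K, hK⟩ := (hone.eventually (lt_mem_nhds (a := 1 - ε / (6 * B))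
    (by have : 0 < ε / (6 * B) := by positivity
        linarith))).exists
  have hK0 : (0 : ℝ) < K + 1 := by positivity
  have c1 := (IntegralsConverge.mul_cutoff hν hμ h' f.continuous hK0).tendsto
  have c2 := (IntegralsConverge.mul_cutoff hν hμ h' (continuous_const (y := (1 : ℝ))) hK0).tendsto
  simp only [one_mul] at c2
  obtain ⟨N₁, hN₁⟩ := Metric.tendsto_atTop.1 c1 (ε / 3) (by positivity)
  obtain ⟨N₂, hN₂⟩ := eventually_atTop.1 (c2.eventually (lt_mem_nhds hK))
  have key : ∀ ρ : Measure ℝ, IsProbabilityMeasure ρ →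
      1 - ε / (6 * B) < ∫ x, cutoff (K + 1) x ∂ρ →
      |∫ x, f x ∂ρ - ∫ x, f x * cutoff (K + 1) x ∂ρ| < ε / 6 := by
    intro ρ _ hρ
    have i1 : Integrable (cutoff (K + 1 : ℝ)) ρ := by
      refine (integrable_const (1 : ℝ)).mono' (hcutm _).aestronglyMeasurable
        (ae_of_all _ fun x => ?_)
      rw [Real.norm_eq_abs, abs_of_nonneg (hcut _ hK0 x).1]
      exact (hcut _ hK0 x).2
    have i2 : Integrable (fun x => f x * cutoff (K + 1 : ℝ) x) ρ := by
      refine (integrable_const B).mono'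
        (f.continuous.measurable.mul (hcutm _)).aestronglyMeasurable (ae_of_all _ fun x => ?_)
      rw [Real.norm_eq_abs, abs_mul, abs_of_nonneg (hcut _ hK0 x).1]
      nlinarith [hfB x, (hcut _ hK0 x).1, (hcut _ hK0 x).2, abs_nonneg (f x)]
    rw [← integral_sub (f.integrable ρ) i2]
    calc |∫ x, f x - f x * cutoff (K + 1) x ∂ρ|
        ≤ ∫ x, B * (1 - cutoff (K + 1) x) ∂ρ := by
          rw [← Real.norm_eq_abs]
          refine norm_integral_le_of_norm_le (((integrable_const (1 : ℝ)).sub i1).const_mul B)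
            (ae_of_all _ fun x => ?_)
          have e : f x - f x * cutoff (K + 1) x = f x * (1 - cutoff (K + 1) x) := by ring
          have := hcut _ hK0 x
          rw [e, Real.norm_eq_abs, abs_mul,
            abs_of_nonneg (a := 1 - cutoff (K + 1 : ℝ) x) (by linarith)]
          exact mul_le_mul_of_nonneg_right (hfB x) (by linarith)
      _ = B * (1 - ∫ x, cutoff (K + 1) x ∂ρ) := by
          rw [integral_const_mul, integral_sub (integrable_const _) i1]
          simp
      _ < B * (ε / (6 * B)) := by
          gcongr
          linarith
      _ = ε / 6 := by field_simp
  refine ⟨max N₁ N₂, fun n hn => ?_⟩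
  have k1 := abs_lt.1 (key μ inferInstance hK)
  have k2 := abs_lt.1 (key (ν n) inferInstance (hN₂ n (le_of_max_le_right hn)))
  have k3 := hN₁ n (le_of_max_le_left hn)
  rw [Real.dist_eq, abs_lt] at k3 ⊢
  constructor <;> linarith [k1.1, k1.2, k2.1, k2.2, k3.1, k3.2]

end

/-! ### Traces as sums over walks, and the edge count -/

theorem Matrix.pow_apply_eq_sum_walks {n : ℕ} (M : Matrix (Fin n) (Fin n) ℝ) (k : ℕ)
    (x y : Fin n) :
    (M ^ k) x y = ∑ i : Fin (k + 1) → Fin n,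
      if i 0 = x ∧ i (Fin.last k) = y then ∏ a : Fin k, M (i a.castSucc) (i a.succ) else 0 := by
  induction k generalizing x y with
  | zero =>
    rw [← (Equiv.funUnique (Fin 1) (Fin n)).symm.sum_comp]
    simp [Matrix.one_apply, ite_and]
  | succ k ih =>
    have hR : (∑ i : Fin (k + 2) → Fin n, if i 0 = x ∧ i (Fin.last (k + 1)) = y then
        ∏ a : Fin (k + 1), M (i a.castSucc) (i a.succ) else 0) =
        ∑ i : Fin (k + 1) → Fin n, if i (Fin.last k) = y then
          M x (i 0) * ∏ a : Fin k, M (i a.castSucc) (i a.succ) else 0 := by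
      rw [← (Fin.consEquiv fun _ : Fin (k + 2) => Fin n).sum_comp, Fintype.sum_prod_type,
        Finset.sum_eq_single x]
      · refine Finset.sum_congr rfl fun i _ => ?_
        simp only [Fin.consEquiv_apply, Fin.cons_zero, true_and, Fin.prod_univ_succ,
          ← Fin.succ_last, Fin.cons_succ, ← Fin.succ_castSucc, Fin.castSucc_zero]
      · intro z _ hz
        refine Finset.sum_eq_zero fun i _ => if_neg ?_
        rintro ⟨h, -⟩
        exact hz (by simpa using h)
      · simp
    rw [hR, pow_succ', Matrix.mul_apply]
    simp only [ih, Finset.mul_sum]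
    rw [Finset.sum_comm]
    refine Finset.sum_congr rfl fun i _ => ?_
    rw [Finset.sum_eq_single (i 0)]
    · simp only [true_and, mul_ite, mul_zero]
    · intro z _ hz
      rw [if_neg, mul_zero]
      rintro ⟨h, -⟩
      exact hz h.symm
    · simp

theorem trace_mul_transpose_pow {n m : ℕ} (A : Matrix (Fin n) (Fin m) ℝ) (k : ℕ) :
    ((A * A.transpose) ^ k).trace = ∑ i : Fin (k + 1) → Fin n, ∑ j : Fin k → Fin m,
      if i 0 = i (Fin.last k) then ∏ a : Fin k, (A (i a.castSucc) (j a) * A (i a.succ) (j a))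
      else 0 := by
  simp only [Matrix.trace, Matrix.diag_apply, Matrix.pow_apply_eq_sum_walks]
  rw [Finset.sum_comm]
  refine Finset.sum_congr rfl fun i _ => ?_
  rw [Finset.sum_eq_single (i 0)]
  · by_cases h : i 0 = i (Fin.last k)
    · simp only [h, and_self, if_true, Matrix.mul_apply, Matrix.transpose_apply]
      rw [Finset.prod_univ_sum, Fintype.piFinset_univ]
    · simp [h, Ne.symm h]
  · intro x _ hx
    exact if_neg fun h => hx h.1.symm
  · simp

open Classical in
/-- The distinct edges of the bipartite walk `i 0, j 0, i 1, j 1, …, i k`. -/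
noncomputable def walkEdges {α β : Type*} {k : ℕ} (i : Fin (k + 1) → α) (j : Fin k → β) :
    Finset (α × β) :=
  Finset.univ.image fun a : Fin k × Bool =>
    (i (bif a.2 then a.1.succ else a.1.castSucc), j a.1)

open Classical in
theorem card_walkEdges_le {α β : Type*} {k : ℕ} (i : Fin (k + 1) → α) (j : Fin k → β) :
    (walkEdges i j).card ≤ 2 * k := by
  refine Finset.card_image_le.trans ?_
  simp [mul_comm]

open Classical in
theorem card_walkEdges_comp {α β α' β' : Type*} {k : ℕ} (i : Fin (k + 1) → α) (j : Fin k → β)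
    {f : α → α'} {g : β → β'} (hf : f.Injective) (hg : g.Injective) :
    (walkEdges (f ∘ i) (g ∘ j)).card = (walkEdges i j).card := by
  have : walkEdges (f ∘ i) (g ∘ j) = (walkEdges i j).image (Prod.map f g) := by
    simp only [walkEdges, Finset.image_image]
    rfl
  rw [this]
  exact Finset.card_image_of_injective _ (hf.prodMap hg)

open Classical in
theorem walkEdges_succ {α β : Type*} {k : ℕ} (i : Fin (k + 2) → α) (j : Fin (k + 1) → β) :
    walkEdges i j = insert (i (Fin.last (k + 1)), j (Fin.last k))
      (insert (i (Fin.last k).castSucc, j (Fin.last k))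
        (walkEdges (fun a => i a.castSucc) (fun a => j a.castSucc))) := by
  ext e
  simp only [walkEdges, Finset.mem_insert, Finset.mem_image, Finset.mem_univ, true_and,
    Prod.exists, Bool.exists_bool, cond_true, cond_false, Fin.exists_fin_succ', Fin.succ_last,
    Fin.succ_castSucc, Nat.succ_eq_add_one, eq_comm (a := e)]
  constructor
  · rintro (h | h | h)
    exacts [.inr (.inr h), .inr (.inl h), .inl h]
  · rintro (h | h | h)
    exacts [.inr (.inr h), .inr (.inl h), .inl h]

-- The graph of a walk is connected. In the induction on length, the two edges added last pay for
-- their new endpoints: an unseen vertex always brings an unseen edge.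
open Classical in
theorem card_image_add_card_image_le {α β : Type*} {k : ℕ} (i : Fin (k + 1) → α)
    (j : Fin k → β) :
    (Finset.univ.image i).card + (Finset.univ.image j).card ≤ (walkEdges i j).card + 1 := by
  induction k with
  | zero =>
    have h1 : (Finset.univ.image i).card ≤ 1 := Finset.card_image_le.trans (by simp)
    have h2 : (Finset.univ.image j).card ≤ 0 := Finset.card_image_le.trans (by simp)
    omega
  | succ k ih =>
    have hi : Finset.univ.image i = insert (i (Fin.last (k + 1)))
        (Finset.univ.image fun a : Fin (k + 1) => i a.castSucc) := by
      ext x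
      simp only [Finset.mem_insert, Finset.mem_image, Finset.mem_univ, true_and,
        Fin.exists_fin_succ' (n := k + 1), eq_comm (a := x)]
      tauto
    have hj : Finset.univ.image j = insert (j (Fin.last k))
        (Finset.univ.image fun a : Fin k => j a.castSucc) := by
      ext x
      simp only [Finset.mem_insert, Finset.mem_image, Finset.mem_univ, true_and,
        Fin.exists_fin_succ' (n := k), eq_comm (a := x)]
      tauto
    have ih' := ih (fun a => i a.castSucc) (fun a => j a.castSucc)
    have hx0 : i (Fin.last k).castSucc ∈ Finset.univ.image fun a : Fin (k + 1) => i a.castSucc :=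
      Finset.mem_image_of_mem _ (Finset.mem_univ _)
    have hE : ∀ e ∈ walkEdges (fun a => i a.castSucc) (fun a => j a.castSucc),
        e.1 ∈ (Finset.univ.image fun a : Fin (k + 1) => i a.castSucc) ∧
        e.2 ∈ (Finset.univ.image fun a : Fin k => j a.castSucc) := by
      intro e he
      obtain ⟨a, -, rfl⟩ := Finset.mem_image.1 he
      exact ⟨Finset.mem_image_of_mem (fun a : Fin (k + 1) => i a.castSucc) (Finset.mem_univ _),
        Finset.mem_image_of_mem (fun a : Fin k => j a.castSucc) (Finset.mem_univ _)⟩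
    rw [walkEdges_succ, hi, hj]
    generalize (Finset.univ.image fun a : Fin (k + 1) => i a.castSucc) = V at *
    generalize (Finset.univ.image fun a : Fin k => j a.castSucc) = V' at *
    generalize walkEdges (fun a => i a.castSucc) (fun a => j a.castSucc) = E at *
    generalize i (Fin.last k).castSucc = x₀ at *
    generalize i (Fin.last (k + 1)) = x at *
    generalize j (Fin.last k) = y at *
    by_cases hy : y ∈ V'
    · rw [Finset.insert_eq_of_mem hy]
      by_cases hx : x ∈ V
      · rw [Finset.insert_eq_of_mem hx]
        have h1 : E.card ≤ (insert (x, y) (insert (x₀, y) E)).card :=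
          Finset.card_le_card ((Finset.subset_insert _ _).trans (Finset.subset_insert _ _))
        omega
      · have h1 : (x, y) ∉ insert (x₀, y) E := by
          rw [Finset.mem_insert]
          rintro (h | h)
          · have hxx : x = x₀ := (Prod.ext_iff.1 h).1
            exact hx (hxx ▸ hx0)
          · exact hx (hE _ h).1
        have h2 : E.card ≤ (insert (x₀, y) E).card := Finset.card_le_card (Finset.subset_insert _ _)
        rw [Finset.card_insert_of_notMem h1, Finset.card_insert_of_notMem hx]
        omega
    · have h0 : (x₀, y) ∉ E := fun h => hy (hE _ h).2
      rw [Finset.card_insert_of_notMem hy]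
      by_cases hx : x ∈ V
      · rw [Finset.insert_eq_of_mem hx]
        have h1 : (insert (x₀, y) E).card ≤ (insert (x, y) (insert (x₀, y) E)).card :=
          Finset.card_le_card (Finset.subset_insert _ _)
        rw [Finset.card_insert_of_notMem h0] at h1
        omega
      · have h1 : (x, y) ∉ insert (x₀, y) E := by
          rw [Finset.mem_insert]
          rintro (h | h)
          · have hxx : x = x₀ := (Prod.ext_iff.1 h).1
            exact hx (hxx ▸ hx0)
          · exact hx (hE _ h).1
        rw [Finset.card_insert_of_notMem h1, Finset.card_insert_of_notMem h0,
          Finset.card_insert_of_notMem hx]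
        omega

/-! ### Patterns of walks and the limiting moments -/

/-- Encoding an equivalence relation by its choice of representatives gives the crude count `kᵏ` of
relations on `Fin k`. -/
theorem Setoid.out_mk_injective (ι : Type*) :
    Function.Injective fun (r : Setoid ι) (a : ι) => (Quotient.mk r a).out := by
  intro r r' h
  ext a b
  have key : ∀ s : Setoid ι, s a b ↔ (Quotient.mk s a).out = (Quotient.mk s b).out := by
    intro s
    rw [Quotient.out_inj]
    exact Quotient.eq.symm
  have ha := congrFun h a
  have hb := congrFun h b
  simp only at ha hb
  rw [key r, key r', ha, hb]

noncomputable instance Setoid.fintypeOfFinite (ι : Type*) [Finite ι] : Fintype (Setoid ι) :=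
  have := Finite.of_injective _ (Setoid.out_mk_injective ι)
  Fintype.ofFinite _

theorem Setoid.card_fin_le (k : ℕ) : Fintype.card (Setoid (Fin k)) ≤ k ^ k := by
  refine (Fintype.card_le_of_injective _ (Setoid.out_mk_injective (Fin k))).trans ?_
  simp

/-- Functions with kernel `r` are the embeddings of the quotient by `r`. -/
def Setoid.kerEquiv {ι β : Type*} (r : Setoid ι) :
    {f : ι → β // Setoid.ker f = r} ≃ (Quotient r ↪ β) where
  toFun f := ⟨Quotient.lift f.1 fun a b h => by
      have h' : r a b := h
      rw [← f.2] at h'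
      exact h', by
    intro a b
    induction a using Quotient.inductionOn
    induction b using Quotient.inductionOn
    rename_i a b
    intro h
    refine Quotient.sound ?_
    change r a b
    rw [← f.2]
    exact h⟩
  invFun e := ⟨fun a => e (Quotient.mk r a), by
    ext a b
    rw [Setoid.ker_def, e.injective.eq_iff]
    exact Quotient.eq⟩
  left_inv f := rfl
  right_inv e := by
    ext a
    induction a using Quotient.inductionOn
    rfl

/-- Functions with kernel `r` are injections of the quotient into `Fin n`, counted by a descending
factorial. -/
theorem sum_eq_sum_setoid {ι : Type*} [Fintype ι] [DecidableEq ι] {n : ℕ} (F : (ι → Fin n) → ℝ)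
    (G : Setoid ι → ℝ) (h : ∀ f, F f = G (Setoid.ker f)) :
    ∑ f, F f = ∑ r, (n.descFactorial (Nat.card (Quotient r)) : ℝ) * G r := by
  classical
  rw [← Finset.sum_fiberwise Finset.univ (fun f : ι → Fin n => Setoid.ker f) F]
  refine Finset.sum_congr rfl fun r _ => ?_
  have h1 : ∀ f ∈ (Finset.univ.filter fun f : ι → Fin n => Setoid.ker f = r), F f = G r := by
    intro f hf
    rw [h, (Finset.mem_filter.1 hf).2]
  rw [Finset.sum_congr rfl h1, Finset.sum_const, nsmul_eq_mul, ← Fintype.card_subtype,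
    Fintype.card_congr (Setoid.kerEquiv r), Fintype.card_embedding_eq, Fintype.card_fin,
    Nat.card_eq_fintype_card]

/-- The number of edges of the pattern of a bipartite walk. -/
noncomputable def patternEdges {k : ℕ} (r : Setoid (Fin (k + 1))) (t : Setoid (Fin k)) : ℕ :=
  (walkEdges (Quotient.mk r) (Quotient.mk t)).card

theorem card_walkEdges_eq_patternEdges {α β : Type*} {k : ℕ} (i : Fin (k + 1) → α)
    (j : Fin k → β) : (walkEdges i j).card = patternEdges (Setoid.ker i) (Setoid.ker j) := by
  rw [patternEdges, ← card_walkEdges_comp _ _ (Setoid.kerLift_injective i)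
    (Setoid.kerLift_injective j)]
  rfl

theorem patternEdges_le {k : ℕ} (r : Setoid (Fin (k + 1))) (t : Setoid (Fin k)) :
    patternEdges r t ≤ 2 * k :=
  card_walkEdges_le _ _

open Classical in
theorem card_image_univ_of_surjective {ι β : Type*} [Fintype ι] {f : ι → β}
    (hf : f.Surjective) : (Finset.univ.image f).card = Nat.card β := by
  have := Fintype.ofSurjective f hf
  rw [Nat.card_eq_fintype_card, ← Finset.card_univ]
  congr 1
  exact Finset.eq_univ_iff_forall.2 fun b => Finset.mem_image.2 ((hf b).imp fun a h => ⟨by simp, h⟩)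

theorem card_quotient_add_card_quotient_le {k : ℕ} (r : Setoid (Fin (k + 1)))
    (t : Setoid (Fin k)) :
    Nat.card (Quotient r) + Nat.card (Quotient t) ≤ patternEdges r t + 1 := by
  have h := card_image_add_card_image_le (Quotient.mk r) (Quotient.mk t)
  rwa [card_image_univ_of_surjective Quotient.mk_surjective,
    card_image_univ_of_surjective Quotient.mk_surjective] at h

open Classical in
/-- The indicator of the patterns of closed walks. -/
noncomputable def closedIndicator {k : ℕ} (r : Setoid (Fin (k + 1))) : ℝ :=
  if r 0 (Fin.last k) then 1 else 0

theorem closedIndicator_mem_Icc {k : ℕ} (r : Setoid (Fin (k + 1))) :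
    0 ≤ closedIndicator r ∧ closedIndicator r ≤ 1 := by
  rw [closedIndicator]
  split_ifs <;> simp

theorem sum_walks_eq_sum_patterns (n m k : ℕ) (p : ℝ) :
    (∑ i : Fin (k + 1) → Fin n, ∑ j : Fin k → Fin m,
      if i 0 = i (Fin.last k) then p ^ (walkEdges i j).card else 0) =
    ∑ r : Setoid (Fin (k + 1)), ∑ t : Setoid (Fin k), closedIndicator r *
      ((n.descFactorial (Nat.card (Quotient r)) : ℝ) * m.descFactorial (Nat.card (Quotient t)) *
        p ^ patternEdges r t) := by
  rw [sum_eq_sum_setoid _ (fun r => ∑ t : Setoid (Fin k),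
    (m.descFactorial (Nat.card (Quotient t)) : ℝ) *
      (closedIndicator r * p ^ patternEdges r t))]
  · refine Finset.sum_congr rfl fun r _ => ?_
    rw [Finset.mul_sum]
    refine Finset.sum_congr rfl fun t _ => ?_
    ring
  · intro i
    refine sum_eq_sum_setoid _ _ fun j => ?_
    rw [card_walkEdges_eq_patternEdges]
    by_cases h : i 0 = i (Fin.last k)
    · rw [if_pos h, closedIndicator, if_pos (show Setoid.ker i 0 (Fin.last k) from h), one_mul]
    · rw [if_neg h, closedIndicator, if_neg (show ¬ Setoid.ker i 0 (Fin.last k) from h), zero_mul]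

/-- The limiting moments: a sum over the patterns of closed walks that are trees. -/
noncomputable def limitMoment (α c : ℝ) (k : ℕ) : ℝ :=
  c⁻¹ ^ k * ∑ r : Setoid (Fin (k + 1)), ∑ t : Setoid (Fin k), closedIndicator r *
    if Nat.card (Quotient r) + Nat.card (Quotient t) = patternEdges r t + 1 then
      α ^ Nat.card (Quotient t) * c ^ patternEdges r t else 0

theorem tendsto_descFactorial_div_pow {a : ℕ → ℕ} {α : ℝ}
    (h : Tendsto (fun n : ℕ => (a n : ℝ) / n) atTop (𝓝 α)) (v : ℕ) :
    Tendsto (fun n : ℕ => ((a n).descFactorial v : ℝ) / (n : ℝ) ^ v) atTop (𝓝 (α ^ v)) := by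
  induction v with
  | zero => simp
  | succ v ih =>
    have h1 : Tendsto (fun n : ℕ => ((a n - v : ℕ) : ℝ) / n) atTop (𝓝 α) := by
      have h2 : Tendsto (fun n : ℕ => (a n : ℝ) / n - v / n) atTop (𝓝 (α - 0)) :=
        h.sub (tendsto_const_nhds.div_atTop tendsto_natCast_atTop_atTop)
      rw [sub_zero] at h2
      refine tendsto_of_tendsto_of_tendsto_of_le_of_le h2 h (fun n => ?_) (fun n => ?_)
      · simp only
        rw [← sub_div]
        gcongr
        rw [sub_le_iff_le_add]
        exact_mod_cast (by omega : a n ≤ a n - v + v)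
      · simp only
        gcongr
        omega
    refine ((h1.mul ih).congr fun n => ?_).trans (by rw [pow_succ'])
    rw [Nat.descFactorial_succ, pow_succ', Nat.cast_mul, div_mul_div_comm]

/-- A pattern with `v + w` vertices and `e` edges has order `n ^ (v + w - 1 - e)`, and this exponent
is never positive. -/
theorem tendsto_sum_patterns {m : ℕ → ℕ} {α c : ℝ}
    (h : Tendsto (fun n : ℕ => (m n : ℝ) / n) atTop (𝓝 α)) (k : ℕ) :
    Tendsto (fun n : ℕ => (n : ℝ)⁻¹ * (c⁻¹ ^ k *
      ∑ r : Setoid (Fin (k + 1)), ∑ t : Setoid (Fin k), closedIndicator r *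
        ((n.descFactorial (Nat.card (Quotient r)) : ℝ) *
          (m n).descFactorial (Nat.card (Quotient t)) * (c / n) ^ patternEdges r t)))
      atTop (𝓝 (limitMoment α c k)) := by
  have h1 : Tendsto (fun n : ℕ => ((n : ℕ) : ℝ) / n) atTop (𝓝 1) := by
    refine tendsto_const_nhds.congr' ?_
    filter_upwards [eventually_gt_atTop 0] with n hn
    rw [div_self]
    positivity
  simp only [limitMoment, mul_left_comm _ (c⁻¹ ^ k)]
  refine Tendsto.const_mul _ ?_
  simp only [Finset.mul_sum]
  refine tendsto_finsetSum _ (fun r _ => tendsto_finsetSum _ fun t _ => ?_)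
  simp only [mul_left_comm _ (closedIndicator r)]
  refine Tendsto.const_mul _ ?_
  have hle := card_quotient_add_card_quotient_le r t
  generalize Nat.card (Quotient r) = v at *
  generalize Nat.card (Quotient t) = w at *
  generalize patternEdges r t = e at *
  -- `d` is the number of independent cycles of the pattern; it is zero exactly for trees.
  obtain ⟨d, hd⟩ := Nat.exists_eq_add_of_le hle
  have h2 : Tendsto (fun n : ℕ => ((n : ℝ)⁻¹) ^ d) atTop (𝓝 (if v + w = e + 1 then 1 else 0)) := by
    split_ifs with hvw
    · have : d = 0 := by omega
      simp [this]
    · have : d ≠ 0 := by omega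
      have h3 := (tendsto_inv_atTop_nhds_zero_nat (𝕜 := ℝ)).pow d
      rwa [zero_pow this] at h3
  have h4 := (((tendsto_descFactorial_div_pow h1 v).mul
    (tendsto_descFactorial_div_pow h w)).mul_const (c ^ e)).mul h2
  have h5 : (1 ^ v * α ^ w * c ^ e * if v + w = e + 1 then 1 else 0) =
      if v + w = e + 1 then α ^ w * c ^ e else 0 := by
    split_ifs <;> ring
  rw [h5] at h4
  refine h4.congr' ?_
  filter_upwards [eventually_gt_atTop 0] with n hn
  have hn' : (n : ℝ) ≠ 0 := by positivity
  have h6 : (n : ℝ) * (n : ℝ) ^ e = (n : ℝ) ^ v * (n : ℝ) ^ w * (n : ℝ) ^ d := by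
    rw [← pow_add, ← pow_add, ← hd, pow_succ']
  have h7 : (n : ℝ)⁻¹ * (c / n) ^ e = c ^ e / ((n : ℝ) * (n : ℝ) ^ e) := by
    rw [div_pow]
    field_simp
  have h8 : (n : ℝ)⁻¹ * ((n.descFactorial v : ℝ) * (m n).descFactorial w * (c / n) ^ e) =
      (n.descFactorial v : ℝ) * (m n).descFactorial w * ((n : ℝ)⁻¹ * (c / n) ^ e) := by ring
  rw [h8, h7, h6]
  simp only [inv_pow]
  field_simp

/-- There are at most `(2k + 1) ^ (2k + 1)` patterns, and `N ^ (2k) / (2k)! ≤ exp N` with `N = 2k +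
1` turns this into a factorial times an exponential. -/
theorem limitMoment_le {α c : ℝ} (hα : 0 < α) (hc : 0 < c) :
    ∃ K C : ℝ, 0 ≤ C ∧ ∀ k, limitMoment α c k ≤ K * C ^ k * (2 * k).factorial := by
  classical
  set D := max 1 α
  set E := max 1 c
  have hD : 1 ≤ D := le_max_left _ _
  have hE : 1 ≤ E := le_max_left _ _
  have hexp := Real.exp_pos 2
  -- `exp 1` and `exp 2` come from `exp (2k + 1)`; the `3` absorbs the leftover factor `2k + 1 ≤
  -- 3ᵏ`.
  refine ⟨Real.exp 1, c⁻¹ * D * E ^ 2 * (3 * Real.exp 2), by positivity, fun k => ?_⟩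
  have h1 : limitMoment α c k ≤ c⁻¹ ^ k *
      ∑ r : Setoid (Fin (k + 1)), ∑ t : Setoid (Fin k), D ^ k * E ^ (2 * k) := by
    rw [limitMoment]
    refine mul_le_mul_of_nonneg_left (Finset.sum_le_sum fun r _ => Finset.sum_le_sum fun t _ => ?_)
      (by positivity)
    refine (mul_le_of_le_one_left ?_ (closedIndicator_mem_Icc r).2).trans ?_
    · split_ifs <;> positivity
    have h0 : 0 ≤ D ^ k * E ^ (2 * k) := by positivity
    split_ifs
    · have hcard : Nat.card (Quotient t) ≤ k := by
        have := Nat.card_le_card_of_surjective (Quotient.mk t) Quotient.mk_surjective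
        simpa using this
      calc α ^ Nat.card (Quotient t) * c ^ patternEdges r t
          ≤ D ^ Nat.card (Quotient t) * E ^ patternEdges r t := by
            gcongr
            · exact le_max_right _ _
            · exact le_max_right _ _
        _ ≤ _ := by
            gcongr
            exact patternEdges_le r t
    · exact h0
  refine h1.trans ?_
  simp only [Finset.sum_const, Finset.card_univ, nsmul_eq_mul]
  have h2 : (Fintype.card (Setoid (Fin (k + 1))) : ℝ) * Fintype.card (Setoid (Fin k)) ≤
      (2 * k + 1 : ℝ) ^ (2 * k) * (2 * k + 1) := by
    have h3 : (Fintype.card (Setoid (Fin (k + 1))) : ℝ) ≤ ((k : ℝ) + 1) ^ (k + 1) := by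
      exact_mod_cast Setoid.card_fin_le (k + 1)
    have h4 : (Fintype.card (Setoid (Fin k)) : ℝ) ≤ (k : ℝ) ^ k := by
      exact_mod_cast Setoid.card_fin_le k
    calc _ ≤ ((k : ℝ) + 1) ^ (k + 1) * (k : ℝ) ^ k := by gcongr
      _ ≤ (2 * k + 1 : ℝ) ^ (k + 1) * (2 * k + 1 : ℝ) ^ k := by
          gcongr <;> linarith [(Nat.cast_nonneg k : (0 : ℝ) ≤ k)]
      _ = _ := by rw [← pow_add, ← pow_succ]; congr 1; omega
  have h5 : (2 * k + 1 : ℝ) ^ (2 * k) ≤ Real.exp 1 * Real.exp 2 ^ k * (2 * k).factorial := by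
    have := Real.pow_div_factorial_le_exp (x := (2 * k + 1 : ℝ)) (by positivity) (2 * k)
    rw [div_le_iff₀ (by positivity)] at this
    refine this.trans (le_of_eq ?_)
    rw [← Real.exp_nat_mul, ← Real.exp_add]
    ring_nf
  have h6 : (2 * k + 1 : ℝ) ≤ 3 ^ k := by
    have := one_add_mul_le_pow (a := (2 : ℝ)) (by norm_num) k
    norm_num at this
    linarith
  calc c⁻¹ ^ k * ((Fintype.card (Setoid (Fin (k + 1))) : ℝ) *
        ((Fintype.card (Setoid (Fin k)) : ℝ) * (D ^ k * E ^ (2 * k))))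
      = c⁻¹ ^ k * (D ^ k * E ^ (2 * k)) * ((Fintype.card (Setoid (Fin (k + 1))) : ℝ) *
        Fintype.card (Setoid (Fin k))) := by ring
    _ ≤ c⁻¹ ^ k * (D ^ k * E ^ (2 * k)) *
        ((Real.exp 1 * Real.exp 2 ^ k * (2 * k).factorial) * 3 ^ k) := by
        refine mul_le_mul_of_nonneg_left (h2.trans ?_) (by positivity)
        gcongr
    _ = _ := by
        rw [pow_mul E]
        simp only [mul_pow]
        ring

/-! ### The bounded difference inequality -/

section BoundedDifferences

open scoped NNReal

variable {α : Type*} [Finite α] [MeasurableSpace α] [MeasurableSingletonClass α]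
  {ν : Measure α} [IsProbabilityMeasure ν]

theorem integral_pi_fin_succ {m : ℕ} (F : (Fin (m + 1) → α) → ℝ) :
    ∫ x, F x ∂(Measure.pi fun _ : Fin (m + 1) => ν) =
      ∫ x, ∫ a, F (Fin.cons a x) ∂ν ∂(Measure.pi fun _ : Fin m => ν) := by
  have h := (measurePreserving_piFinSuccAbove (fun _ : Fin (m + 1) => ν) 0).symm
  rw [← h.integral_comp', integral_prod_symm]
  · simp [MeasurableEquiv.piFinSuccAbove_symm_apply, Fin.insertNthEquiv, Fin.insertNth_zero']
  · exact Integrable.of_finite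

/-- Averaging over the first coordinate preserves the bounded differences in the others, so
induction handles the average. Hoeffding's lemma handles the first coordinate: its range has length
at most `2b`, so it contributes `b²`. -/
theorem hasSubgaussianMGF_of_bounded_differences {m : ℕ} {b : ℝ≥0} (f : (Fin m → α) → ℝ)
    (hf : ∀ x j a, |f (Function.update x j a) - f x| ≤ b) :
    HasSubgaussianMGF (fun x => f x - ∫ y, f y ∂(Measure.pi fun _ : Fin m => ν)) (m * b ^ 2)
      (Measure.pi fun _ : Fin m => ν) := by
  refine ⟨fun t => Integrable.of_finite, fun t => ?_⟩
  rw [mgf]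
  induction m with
  | zero =>
    obtain ⟨v, hv⟩ : ∃ v, ∀ x, f x = v :=
      ⟨f default, fun x => congrArg f (Subsingleton.elim _ _)⟩
    simp [hv]
  | succ m ih =>
    set g : (Fin m → α) → ℝ := fun x => ∫ a, f (Fin.cons a x) ∂ν with hg
    have hgd : ∀ x j a, |g (Function.update x j a) - g x| ≤ b := by
      intro x j a
      rw [hg]
      simp only
      rw [← integral_sub Integrable.of_finite Integrable.of_finite]
      have h2 : ∀ᵐ a' ∂ν, ‖f (Fin.cons a' (Function.update x j a)) - f (Fin.cons a' x)‖ ≤ b := by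
        refine ae_of_all _ fun a' => ?_
        rw [Fin.cons_update]
        exact hf _ _ _
      simpa using norm_integral_le_of_norm_le_const h2
    have hE : ∫ y, f y ∂(Measure.pi fun _ : Fin (m + 1) => ν) =
        ∫ y, g y ∂(Measure.pi fun _ : Fin m => ν) := integral_pi_fin_succ f
    rw [hE, integral_pi_fin_succ]
    set e := ∫ y, g y ∂(Measure.pi fun _ : Fin m => ν)
    have hin : ∀ x, ∫ a, Real.exp (t * (f (Fin.cons a x) - g x)) ∂ν ≤
        Real.exp (b ^ 2 * t ^ 2 / 2) := by
      intro x
      obtain ⟨a₀⟩ : Nonempty α := nonempty_of_isProbabilityMeasure ν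
      have h1 : ∀ᵐ a ∂ν, f (Fin.cons a x) ∈
          Set.Icc (f (Fin.cons a₀ x) - b) (f (Fin.cons a₀ x) + b) := by
        refine ae_of_all _ fun a => ?_
        have h2 := hf (Fin.cons a₀ x) 0 a
        rw [Fin.update_cons_zero, abs_le] at h2
        constructor <;> linarith [h2.1, h2.2]
      have h3 := (hasSubgaussianMGF_of_mem_Icc (measurable_of_finite _).aemeasurable h1).mgf_le t
      refine h3.trans (Real.exp_le_exp.2 (le_of_eq ?_))
      have : f (Fin.cons a₀ x) + b - (f (Fin.cons a₀ x) - b) = 2 * b := by ring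
      simp [this]
    calc ∫ x, ∫ a, Real.exp (t * (f (Fin.cons a x) - e)) ∂ν ∂(Measure.pi fun _ : Fin m => ν)
        = ∫ x, Real.exp (t * (g x - e)) * ∫ a, Real.exp (t * (f (Fin.cons a x) - g x)) ∂ν
            ∂(Measure.pi fun _ : Fin m => ν) := by
          refine integral_congr_ae (ae_of_all _ fun x => ?_)
          simp only
          rw [← integral_const_mul]
          refine integral_congr_ae (ae_of_all _ fun a => ?_)
          simp only
          rw [← Real.exp_add]
          ring_nf
      _ ≤ ∫ x, Real.exp (t * (g x - e)) * Real.exp (b ^ 2 * t ^ 2 / 2)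
            ∂(Measure.pi fun _ : Fin m => ν) := by
          refine integral_mono Integrable.of_finite Integrable.of_finite fun x => ?_
          exact mul_le_mul_of_nonneg_left (hin x) (Real.exp_pos _).le
      _ ≤ Real.exp ((m * b ^ 2 : ℝ≥0) * t ^ 2 / 2) * Real.exp (b ^ 2 * t ^ 2 / 2) := by
          rw [integral_mul_const]
          exact mul_le_mul_of_nonneg_right (ih g hgd) (Real.exp_pos _).le
      _ = Real.exp (((m + 1 : ℕ) * b ^ 2 : ℝ≥0) * t ^ 2 / 2) := by
          rw [← Real.exp_add]
          push_cast
          ring_nf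

theorem measure_abs_sub_integral_ge_le {m : ℕ} {b : ℝ≥0} (f : (Fin m → α) → ℝ)
    (hf : ∀ x j a, |f (Function.update x j a) - f x| ≤ b) {ε : ℝ} (hε : 0 ≤ ε) :
    (Measure.pi fun _ : Fin m => ν).real
      {x | ε ≤ |f x - ∫ y, f y ∂(Measure.pi fun _ : Fin m => ν)|} ≤
        2 * Real.exp (-ε ^ 2 / (2 * (m * b ^ 2))) := by
  have h := hasSubgaussianMGF_of_bounded_differences (ν := ν) f hf
  have h1 := h.measure_ge_le hε
  have h2 := h.neg.measure_ge_le hε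
  push_cast at h1 h2
  calc _ ≤ (Measure.pi fun _ : Fin m => ν).real
        ({x | ε ≤ f x - ∫ y, f y ∂(Measure.pi fun _ : Fin m => ν)} ∪
          {x | ε ≤ (-fun x => f x - ∫ y, f y ∂(Measure.pi fun _ : Fin m => ν)) x}) := by
        refine measureReal_mono fun x hx => ?_
        rw [Set.mem_ofPred_eq] at hx
        exact le_abs.1 hx
    _ ≤ _ := measureReal_union_le _ _
    _ ≤ _ := by linarith

end BoundedDifferences

/-! ### Bernoulli matrices and their mean spectral measure -/

/-- The `0`-`1` matrix with columns `B j`. -/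
def boolMatrix {n m : ℕ} (B : Fin m → Fin n → Bool) : Matrix (Fin n) (Fin m) ℝ :=
  Matrix.of fun i j => if B j i then 1 else 0

theorem boolMatrix_apply {n m : ℕ} (B : Fin m → Fin n → Bool) (i : Fin n) (j : Fin m) :
    boolMatrix B i j = if B j i then 1 else 0 := rfl

/-- The law of an `n × m` array of independent Bernoulli variables, indexed by columns. -/
noncomputable def boolLaw (n m : ℕ) (p : unitInterval) : Measure (Fin m → Fin n → Bool) :=
  Measure.pi fun _ => Measure.pi fun _ => bernoulliMeasure true false p

instance (n m : ℕ) (p : unitInterval) : IsProbabilityMeasure (boolLaw n m p) := by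
  rw [boolLaw]; infer_instance

theorem integral_prod_boolMatrix {n m : ℕ} (p : unitInterval) (S : Finset (Fin n × Fin m)) :
    ∫ B, ∏ e ∈ S, boolMatrix B e.1 e.2 ∂(boolLaw n m p) = (p : ℝ) ^ S.card := by
  have h1 : ∀ B : Fin m → Fin n → Bool, ∏ e ∈ S, boolMatrix B e.1 e.2 =
      ∏ j : Fin m, ∏ i : Fin n, if (i, j) ∈ S then (if B j i then (1 : ℝ) else 0) else 1 := by
    intro B
    rw [Finset.prod_comm, ← Fintype.prod_prod_type', ← Finset.prod_subset (Finset.subset_univ S)]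
    · refine Finset.prod_congr rfl fun e he => ?_
      simp [he, boolMatrix_apply]
    · intro e _ he
      simp [he]
  have h2 : ∀ (i : Fin n) (j : Fin m),
      ∫ b, (if (i, j) ∈ S then (if b then (1 : ℝ) else 0) else 1) ∂(bernoulliMeasure true false p)
        = if (i, j) ∈ S then (p : ℝ) else 1 := by
    intro i j
    split_ifs
    · rw [integral_fintype Integrable.of_finite]
      simp
    · simp
  simp only [h1]
  rw [boolLaw, integral_fintype_prod_eq_prod (fun j (x : Fin n → Bool) =>
    ∏ i : Fin n, if (i, j) ∈ S then (if x i then (1 : ℝ) else 0) else 1)]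
  have h3 : ∀ j : Fin m, ∫ x : Fin n → Bool,
      (∏ i : Fin n, if (i, j) ∈ S then (if x i then (1 : ℝ) else 0) else 1)
        ∂(Measure.pi fun _ => bernoulliMeasure true false p) =
      ∏ i : Fin n, if (i, j) ∈ S then (p : ℝ) else 1 := by
    intro j
    rw [integral_fintype_prod_eq_prod (fun i (b : Bool) =>
      if (i, j) ∈ S then (if b then (1 : ℝ) else 0) else 1)]
    simp only [h2]
  simp only [h3]
  rw [Finset.prod_comm, ← Fintype.prod_prod_type', Finset.prod_ite]
  simp

/-- For 0-1 entries an edge walked several times counts once, so only the number of distinct edges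
matters. -/
theorem Finset.prod_image_of_idempotent {ι κ : Type*} [DecidableEq κ] (s : Finset ι)
    (g : ι → κ) (f : κ → ℝ)
    (hf : ∀ x, f x * f x = f x) : ∏ a ∈ s, f (g a) = ∏ e ∈ s.image g, f e := by
  classical
  induction s using Finset.induction_on with
  | empty => simp
  | insert a s ha ih =>
    rw [Finset.prod_insert ha, ih, Finset.image_insert]
    by_cases h : g a ∈ s.image g
    · rw [Finset.insert_eq_of_mem h, ← Finset.mul_prod_erase _ _ h, ← mul_assoc, hf]
    · rw [Finset.prod_insert h]

open Classical in
theorem prod_walkEdges {α β : Type*} {k : ℕ} (i : Fin (k + 1) → α) (j : Fin k → β)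
    (f : α → β → ℝ) (hf : ∀ x y, f x y * f x y = f x y) :
    ∏ e ∈ walkEdges i j, f e.1 e.2 =
      ∏ a : Fin k, (f (i a.castSucc) (j a) * f (i a.succ) (j a)) := by
  rw [walkEdges, ← Finset.prod_image_of_idempotent _ _ (fun e : α × β => f e.1 e.2)
    (fun e => hf e.1 e.2), Fintype.prod_prod_type]
  simp [mul_comm]

theorem integral_trace_pow {n m : ℕ} (p : unitInterval) (k : ℕ) :
    ∫ B, ((boolMatrix B * (boolMatrix B).transpose) ^ k).trace ∂(boolLaw n m p) =
      ∑ r : Setoid (Fin (k + 1)), ∑ t : Setoid (Fin k), closedIndicator r *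
      ((n.descFactorial (Nat.card (Quotient r)) : ℝ) * m.descFactorial (Nat.card (Quotient t)) *
        (p : ℝ) ^ patternEdges r t) := by
  rw [← sum_walks_eq_sum_patterns]
  simp only [trace_mul_transpose_pow]
  rw [integral_finsetSum _ fun _ _ => Integrable.of_finite]
  refine Finset.sum_congr rfl fun i _ => ?_
  rw [integral_finsetSum _ fun _ _ => Integrable.of_finite]
  refine Finset.sum_congr rfl fun j _ => ?_
  split_ifs
  · rw [← integral_prod_boolMatrix]
    congr 1
    ext B
    exact (prod_walkEdges i j _ fun x y => by rw [boolMatrix_apply]; split_ifs <;> simp).symm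
  · simp

/-- The average of the spectral measure of `c⁻¹ A Aᵀ` for a Bernoulli matrix `A`. -/
noncomputable def meanSpectralMeasure (c : ℝ) (n m : ℕ) (p : unitInterval) : Measure ℝ :=
  ∑ B : Fin m → Fin n → Bool,
    boolLaw n m p {B} • spectralMeasure (wishart_isHermitian c (boolMatrix B))

theorem integrable_meanSpectralMeasure {c : ℝ} {n m : ℕ} (hn : n ≠ 0) (p : unitInterval)
    (f : ℝ → ℝ) : Integrable f (meanSpectralMeasure c n m p) := by
  rw [meanSpectralMeasure, integrable_finsetSum_measure]
  exact fun B _ => (integrable_spectralMeasure hn _ f).smul_measure (measure_ne_top _ _)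

theorem integral_meanSpectralMeasure {c : ℝ} {n m : ℕ} (hn : n ≠ 0) (p : unitInterval)
    (f : ℝ → ℝ) : ∫ x, f x ∂(meanSpectralMeasure c n m p) =
      ∫ B, ∫ x, f x ∂(spectralMeasure (wishart_isHermitian c (boolMatrix B)))
        ∂(boolLaw n m p) := by
  rw [integral_fintype (μ := boolLaw n m p) Integrable.of_finite, meanSpectralMeasure,
    integral_finsetSum_measure]
  · simp [integral_smul_measure, measureReal_def]
  · exact fun B _ => (integrable_spectralMeasure hn _ f).smul_measure (measure_ne_top _ _)

theorem isProbabilityMeasure_meanSpectralMeasure {c : ℝ} {n m : ℕ} (hn : n ≠ 0)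
    (p : unitInterval) : IsProbabilityMeasure (meanSpectralMeasure c n m p) where
  measure_univ := by
    have h : ∀ B : Fin m → Fin n → Bool,
        spectralMeasure (wishart_isHermitian c (boolMatrix B)) Set.univ = 1 := fun B =>
      (isProbabilityMeasure_spectralMeasure hn _).measure_univ
    simp only [meanSpectralMeasure, Measure.coe_finsetSum, Finset.sum_apply, Measure.smul_apply, h,
      smul_eq_mul, mul_one]
    rw [sum_measure_singleton]
    simp

theorem ae_nonneg_spectralMeasure {c : ℝ} (hc : 0 < c) {n m : ℕ} (X : Matrix (Fin n) (Fin m) ℝ) :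
    ∀ᵐ x ∂(spectralMeasure (wishart_isHermitian c X)), 0 ≤ x := by
  rw [ae_iff, spectralMeasure]
  simp only [Measure.smul_apply, Measure.coe_finsetSum, Finset.sum_apply, smul_eq_mul, mul_eq_zero,
    Finset.sum_eq_zero_iff]
  right
  intro i _
  have := (wishart_posSemidef hc X).eigenvalues_nonneg i
  have hm : MeasurableSet {a : ℝ | ¬ 0 ≤ a} := measurableSet_Ici.compl
  rw [Measure.dirac_apply' _ hm]
  simpa using this

theorem ae_nonneg_meanSpectralMeasure {c : ℝ} (hc : 0 < c) {n m : ℕ} (p : unitInterval) :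
    ∀ᵐ x ∂(meanSpectralMeasure c n m p), 0 ≤ x := by
  rw [ae_iff, meanSpectralMeasure]
  simp only [Measure.smul_apply, Measure.coe_finsetSum, Finset.sum_apply, smul_eq_mul, mul_eq_zero,
    Finset.sum_eq_zero_iff]
  exact fun B _ => .inr (ae_iff.1 (ae_nonneg_spectralMeasure hc (boolMatrix B)))

theorem integral_pow_meanSpectralMeasure {c : ℝ} {n m : ℕ} (hn : n ≠ 0) (p : unitInterval)
    (k : ℕ) : ∫ x, x ^ k ∂(meanSpectralMeasure c n m p) = (n : ℝ)⁻¹ * (c⁻¹ ^ k *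
      ∑ r : Setoid (Fin (k + 1)), ∑ t : Setoid (Fin k), closedIndicator r *
        ((n.descFactorial (Nat.card (Quotient r)) : ℝ) *
          m.descFactorial (Nat.card (Quotient t)) * (p : ℝ) ^ patternEdges r t)) := by
  rw [integral_meanSpectralMeasure hn, ← integral_trace_pow, ← integral_const_mul,
    ← integral_const_mul]
  congr 1
  ext B
  rw [integral_spectralMeasure, ← trace_pow_eq_sum_eigenvalues, wishart, smul_pow,
    Matrix.trace_smul, smul_eq_mul]

/-- The parameter `c / n`, truncated at `1`. -/
noncomputable def bernoulliParam (c : ℝ) (n : ℕ) : unitInterval :=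
  Set.projIcc 0 1 zero_le_one (c / n)

theorem coe_bernoulliParam {c : ℝ} (hc : 0 < c) {n : ℕ} (hn : ⌈c⌉₊ + 1 ≤ n) :
    (bernoulliParam c n : ℝ) = c / n := by
  have h1 : c ≤ n := (Nat.le_ceil c).trans (by exact_mod_cast (by omega : ⌈c⌉₊ ≤ n))
  have h2 : (0 : ℝ) < n := hc.trans_le h1
  rw [bernoulliParam, Set.projIcc_of_mem zero_le_one ⟨by positivity, (div_le_one h2).2 h1⟩]

/-- The Stieltjes kernel `x ↦ 1 / (|x| + s)`. -/
noncomputable def stieltjesKernel {s : ℝ} (hs : 0 < s) : ℝ →ᵇ ℝ :=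
  BoundedContinuousFunction.ofNormedAddCommGroup (fun x => (|x| + s)⁻¹)
    (Continuous.inv₀ (by fun_prop) fun x => by positivity) s⁻¹ fun x => by
      rw [Real.norm_eq_abs, abs_of_nonneg (by positivity)]
      exact inv_anti₀ hs (by linarith [abs_nonneg x])

theorem integral_stieltjesKernel {s : ℝ} (hs : 0 < s) {ρ : Measure ℝ} (h : ∀ᵐ x ∂ρ, 0 ≤ x) :
    ∫ x, stieltjesKernel hs x ∂ρ = ∫ x, (x + s)⁻¹ ∂ρ := by
  refine integral_congr_ae ?_
  filter_upwards [h] with x hx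
  change (|x| + s)⁻¹ = _
  rw [abs_of_nonneg hx]

theorem exists_tendsto_stieltjes_mean {α c : ℝ} (hα : 0 < α) (hc : 0 < c) {m : ℕ → ℕ}
    (hm : Tendsto (fun n : ℕ => (m n : ℝ) / n) atTop (𝓝 α)) :
    ∃ μ : ProbabilityMeasure ℝ, HasNonnegMoments μ (limitMoment α c) ∧ ∀ s > 0,
      Tendsto (fun n => ∫ x, (x + s)⁻¹ ∂(meanSpectralMeasure c n (m n) (bernoulliParam c n)))
        atTop (𝓝 (∫ x, (x + s)⁻¹ ∂(μ : Measure ℝ))) := by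
  -- From this index on, `c / n` is a genuine parameter and the mean spectral measure is a
  -- probability measure.
  set N := ⌈c⌉₊ + 1 with hN
  have hN0 : ∀ i, i + N ≠ 0 := fun i => by omega
  obtain ⟨K, C, hC, hle⟩ := limitMoment_le hα hc
  obtain ⟨μ, hμ, hlim⟩ := exists_tendsto_of_moments
    (ν := fun i => ⟨meanSpectralMeasure c (i + N) (m (i + N)) (bernoulliParam c (i + N)),
      isProbabilityMeasure_meanSpectralMeasure (hN0 i) _⟩) (M := limitMoment α c)
    (fun i => ae_nonneg_meanSpectralMeasure hc _)
    (fun i k => integrable_meanSpectralMeasure (hN0 i) _ _)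
    (fun k => by
      refine (((tendsto_add_atTop_iff_nat N).2 (tendsto_sum_patterns hm k)).congr fun i => ?_)
      simp only [ProbabilityMeasure.coe_mk]
      rw [integral_pow_meanSpectralMeasure (hN0 i), coe_bernoulliParam hc (by omega)])
    hC hle
  refine ⟨μ, hμ, fun s hs => (tendsto_add_atTop_iff_nat N).1 ?_⟩
  have h := (ProbabilityMeasure.tendsto_iff_forall_integral_tendsto.1 hlim) (stieltjesKernel hs)
  rw [integral_stieltjesKernel hs hμ.ae_nonneg] at h
  refine h.congr fun i => ?_
  exact integral_stieltjesKernel hs (ae_nonneg_meanSpectralMeasure hc _)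

/-- The sequence `⌊α n⌋` serves only to produce the law; determinacy identifies it with the limit
for any other `m`. -/
theorem exists_hasNonnegMoments_limitMoment {α c : ℝ} (hα : 0 < α) (hc : 0 < c) :
    ∃ μ : ProbabilityMeasure ℝ, HasNonnegMoments μ (limitMoment α c) := by
  obtain ⟨μ, hμ, -⟩ := exists_tendsto_stieltjes_mean hα hc (m := fun n => ⌊α * n⌋₊)
    ((tendsto_nat_floor_mul_div_atTop hα.le).comp tendsto_natCast_atTop_atTop)
  exact ⟨μ, hμ⟩

theorem tendsto_stieltjes_mean {α c : ℝ} (hα : 0 < α) (hc : 0 < c) {m : ℕ → ℕ}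
    (hm : Tendsto (fun n : ℕ => (m n : ℝ) / n) atTop (𝓝 α)) {μ : Measure ℝ}
    [IsProbabilityMeasure μ] (hμ : HasNonnegMoments μ (limitMoment α c)) {s : ℝ} (hs : 0 < s) :
    Tendsto (fun n => ∫ x, (x + s)⁻¹ ∂(meanSpectralMeasure c n (m n) (bernoulliParam c n)))
      atTop (𝓝 (∫ x, (x + s)⁻¹ ∂μ)) := by
  obtain ⟨μ', hμ', h⟩ := exists_tendsto_stieltjes_mean hα hc hm
  obtain ⟨K, C, hC, hle⟩ := limitMoment_le hα hc
  have : μ = μ' := hμ.eq hμ' hC hle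
  rw [this]
  exact h s hs

/-! ### Almost sure convergence of the Stieltjes transforms -/

theorem integral_inv_add_spectralMeasure (c s : ℝ) {n m : ℕ} (X : Matrix (Fin n) (Fin m) ℝ) :
    ∫ x, (x + s)⁻¹ ∂(spectralMeasure (wishart_isHermitian c X)) =
      (n : ℝ)⁻¹ * stieltjesSum c s X :=
  integral_spectralMeasure _ _

/-- One coordinate of `B` is a whole column, so an update is a rank-one change. This keeps the
number of independent coordinates of order `n`; with single entries it would be of order `n²`, too
many for concentration at scale `n`. -/
theorem abs_stieltjesSum_boolMatrix_update_sub_le {c s : ℝ} (hc : 0 < c) (hs : 0 < s) {n m : ℕ}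
    (B : Fin m → Fin n → Bool) (j : Fin m) (a : Fin n → Bool) :
    |stieltjesSum c s (boolMatrix (Function.update B j a)) - stieltjesSum c s (boolMatrix B)| ≤
      2 * s⁻¹ := by
  refine abs_stieltjesSum_sub_le hc hs _ _ ?_
  have : boolMatrix (Function.update B j a) - boolMatrix B =
      Matrix.vecMulVec (fun i => (boolMatrix (Function.update B j a) - boolMatrix B) i j)
        (Pi.single j 1) := by
    ext i l
    rw [Matrix.vecMulVec_apply]
    by_cases h : l = j
    · subst h
      simp
    · simp [boolMatrix_apply, h]
  rw [this]
  exact Matrix.rank_vecMulVec_le _ _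

open scoped NNReal in
theorem ae_tendsto_stieltjesSum_boolMatrix {α c : ℝ} (hα : 0 < α) (hc : 0 < c) {m : ℕ → ℕ}
    (hm : Tendsto (fun n : ℕ => (m n : ℝ) / n) atTop (𝓝 α)) {μ : Measure ℝ}
    [IsProbabilityMeasure μ] (hμ : HasNonnegMoments μ (limitMoment α c))
    {Ω : Type*} [MeasurableSpace Ω] {P : Measure Ω}
    {B : (n : ℕ) → Ω → Fin (m n) → Fin n → Bool} {N : ℕ}
    (hB : ∀ n, N ≤ n → AEMeasurable (B n) P ∧
      P.map (B n) = boolLaw n (m n) (bernoulliParam c n)) {s : ℝ} (hs : 0 < s) :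
    ∀ᵐ ω ∂P, Tendsto (fun n : ℕ => (n : ℝ)⁻¹ * stieltjesSum c s (boolMatrix (B n ω))) atTop
      (𝓝 (∫ x, (x + s)⁻¹ ∂μ)) := by
  set E : ℕ → ℝ := fun n =>
    ∫ B, stieltjesSum c s (boolMatrix B) ∂(boolLaw n (m n) (bernoulliParam c n)) with hE
  have hEt : Tendsto (fun n : ℕ => (n : ℝ)⁻¹ * E n) atTop (𝓝 (∫ x, (x + s)⁻¹ ∂μ)) := by
    refine (tendsto_stieltjes_mean hα hc hm hμ hs).congr' ?_
    filter_upwards [eventually_ne_atTop 0] with n hn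
    rw [integral_meanSpectralMeasure hn, hE, ← integral_const_mul]
    simp only [integral_inv_add_spectralMeasure]
  set b : ℝ≥0 := ⟨2 * s⁻¹, by positivity⟩ with hb
  have hb0 : (0 : ℝ) < b := by
    change 0 < 2 * s⁻¹
    positivity
  obtain ⟨N₁, hN₁⟩ : ∃ N₁ : ℕ, ∀ n, N₁ ≤ n → 0 < n ∧ N ≤ n ∧ 0 < m n ∧
      (m n : ℝ) ≤ (α + 1) * n := by
    have h1 := hm.eventually (lt_mem_nhds hα)
    have h2 := hm.eventually (gt_mem_nhds (lt_add_one α))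
    refine eventually_atTop.1 ?_
    filter_upwards [h1, h2, eventually_gt_atTop 0, eventually_ge_atTop N] with n h1 h2 h3 h4
    have h3' : (0 : ℝ) < n := by exact_mod_cast h3
    refine ⟨h3, h4, ?_, ?_⟩
    · rw [pos_iff_ne_zero]
      rintro h
      simp [h] at h1
    · exact ((div_lt_iff₀ h3').1 h2).le
  have hdev : ∀ ε : ℝ, 0 < ε → ∀ᵐ ω ∂P, ∀ᶠ n : ℕ in atTop,
      |stieltjesSum c s (boolMatrix (B n ω)) - E n| < ε * n := by
    intro ε hε
    -- For `m n ≤ (α + 1) n`, the exponent `(ε n)² / (2 (m n) b²)` is at least `κ n`, which makes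
    -- the deviation probabilities summable.
    set κ : ℝ := ε ^ 2 / (2 * ((α + 1) * b ^ 2)) with hκ
    have hκ0 : 0 < κ := by positivity
    have hP : ∀ i : ℕ, P {ω | ε * (i + N₁ : ℕ) ≤
        |stieltjesSum c s (boolMatrix (B (i + N₁) ω)) - E (i + N₁)|} ≤
        ENNReal.ofReal (2 * Real.exp (-κ) ^ i) := by
      intro i
      set n := i + N₁ with hn
      obtain ⟨hn0, hnN, hmn0, hmn⟩ := hN₁ n (by omega)
      have hn0' : (0 : ℝ) < n := by exact_mod_cast hn0
      have hmn0' : (0 : ℝ) < m n := by exact_mod_cast hmn0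
      have h1 : P {ω | ε * n ≤ |stieltjesSum c s (boolMatrix (B n ω)) - E n|} =
          boolLaw n (m n) (bernoulliParam c n)
            {B | ε * n ≤ |stieltjesSum c s (boolMatrix B) - E n|} := by
        rw [← (hB n hnN).2, Measure.map_apply_of_aemeasurable (hB n hnN).1
          (Set.toFinite _).measurableSet]
        rfl
      rw [h1, ← ofReal_measureReal]
      refine ENNReal.ofReal_le_ofReal ?_
      refine (measure_abs_sub_integral_ge_le (b := b)
        (fun B : Fin (m n) → Fin n → Bool => stieltjesSum c s (boolMatrix B))
        (fun B j a => abs_stieltjesSum_boolMatrix_update_sub_le hc hs B j a)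
        (ε := ε * n) (by positivity)).trans ?_
      rw [← Real.exp_nat_mul]
      refine mul_le_mul_of_nonneg_left (Real.exp_le_exp.2 ?_) zero_le_two
      have h2 : κ * n ≤ (ε * n) ^ 2 / (2 * (m n * b ^ 2)) := by
        rw [hκ, le_div_iff₀ (by positivity)]
        calc ε ^ 2 / (2 * ((α + 1) * b ^ 2)) * n * (2 * (m n * b ^ 2))
            ≤ ε ^ 2 / (2 * ((α + 1) * b ^ 2)) * n * (2 * (((α + 1) * n) * b ^ 2)) := by gcongr
          _ = (ε * n) ^ 2 := by field_simp
      have h3 : (i : ℝ) ≤ n := by exact_mod_cast (by omega : i ≤ n)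
      rw [neg_div]
      nlinarith
    have hsum : (∑' i : ℕ, P {ω | ε * (i + N₁ : ℕ) ≤
        |stieltjesSum c s (boolMatrix (B (i + N₁) ω)) - E (i + N₁)|}) ≠ ∞ := by
      refine ne_top_of_le_ne_top ?_ (ENNReal.tsum_le_tsum hP)
      refine Summable.tsum_ofReal_ne_top ?_
      refine (summable_geometric_of_lt_one (Real.exp_pos _).le ?_).mul_left 2
      rw [Real.exp_lt_one_iff]
      linarith
    filter_upwards [ae_eventually_notMem hsum] with ω hω
    obtain ⟨N₂, hN₂⟩ := eventually_atTop.1 hω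
    filter_upwards [eventually_ge_atTop (N₂ + N₁)] with n hn
    have := hN₂ (n - N₁) (by omega)
    rw [Nat.sub_add_cancel (by omega : N₁ ≤ n)] at this
    exact not_le.1 this
  have hall : ∀ᵐ ω ∂P, ∀ l : ℕ, ∀ᶠ n : ℕ in atTop,
      |stieltjesSum c s (boolMatrix (B n ω)) - E n| < 1 / ((l : ℝ) + 1) * n :=
    ae_all_iff.2 fun l => hdev _ (by positivity)
  filter_upwards [hall] with ω hω
  have hdiff : Tendsto (fun n : ℕ => (n : ℝ)⁻¹ * stieltjesSum c s (boolMatrix (B n ω)) -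
      (n : ℝ)⁻¹ * E n) atTop (𝓝 0) := by
    rw [Metric.tendsto_nhds]
    intro ε hε
    obtain ⟨l, hl⟩ := exists_nat_one_div_lt hε
    filter_upwards [hω l, eventually_gt_atTop 0] with n hn hn0
    have hn0' : (0 : ℝ) < n := by exact_mod_cast hn0
    rw [Real.dist_eq, sub_zero, ← mul_sub, abs_mul, abs_of_pos (inv_pos.2 hn0'),
      inv_mul_lt_iff₀ hn0']
    calc _ < 1 / ((l : ℝ) + 1) * n := hn
      _ ≤ n * ε := by rw [mul_comm]; gcongr
  simpa using hdiff.add hEt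

/-! ### Transfer to real Bernoulli and centered entries -/

/-- Reading off which entries equal `1` loses nothing almost surely, and places the columns in a
finite space, where the concentration inequality applies. -/
theorem HasIIDEntries.boolMatrix {Ω : Type*} [MeasurableSpace Ω] {P : Measure Ω}
    {n m : ℕ} {A : Ω → Matrix (Fin n) (Fin m) ℝ} {p : unitInterval}
    (h : HasIIDEntries P A (bernoulliLaw p)) :
    ∃ B : Ω → Fin m → Fin n → Bool, AEMeasurable B P ∧ P.map B = boolLaw n m p ∧
      ∀ᵐ ω ∂P, A ω = boolMatrix (B ω) := by
  have hdec : Measurable fun x : ℝ => decide (x = 1) := by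
    refine measurable_to_bool ?_
    have : (fun x : ℝ => decide (x = 1)) ⁻¹' {true} = {1} := by
      ext x
      simp
    rw [this]
    exact measurableSet_singleton 1
  have hBm : AEMeasurable (fun ω => fun (j : Fin m) (i : Fin n) => decide (A ω i j = 1)) P := by
    refine aemeasurable_pi_iff.2 fun j => aemeasurable_pi_iff.2 fun i => ?_
    exact hdec.comp_aemeasurable (h.law i j).aemeasurable
  refine ⟨_, hBm, ?_, ?_⟩
  · refine Measure.ext_of_singleton fun b => ?_
    rw [Measure.map_apply_of_aemeasurable hBm (measurableSet_singleton b), boolLaw,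
      Measure.pi_singleton]
    have hset : (fun ω => fun (j : Fin m) (i : Fin n) => decide (A ω i j = 1)) ⁻¹' {b} =
        ⋂ e ∈ (Finset.univ : Finset (Fin n × Fin m)), (fun ω => A ω e.1 e.2) ⁻¹'
          ((fun x : ℝ => decide (x = 1)) ⁻¹' {b e.2 e.1}) := by
      ext ω
      simp only [Set.mem_preimage, Set.mem_singleton_iff, funext_iff, Finset.mem_univ,
        Set.iInter_true, Set.mem_iInter, Prod.forall]
      exact forall_comm
    rw [hset, h.indep.measure_inter_preimage_eq_mul _ fun e _ => hdec (measurableSet_singleton _),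
      Fintype.prod_prod_type, Finset.prod_comm]
    refine Finset.prod_congr rfl fun j _ => ?_
    rw [Measure.pi_singleton]
    refine Finset.prod_congr rfl fun i _ => ?_
    have h1 := (h.law i j).measure_eq
      (p := fun x => x ∈ (fun x : ℝ => decide (x = 1)) ⁻¹' {b j i})
      (hdec (measurableSet_singleton _))
    refine h1.trans ?_
    classical
    change bernoulliMeasure 1 0 p ((fun x : ℝ => decide (x = 1)) ⁻¹' {b j i}) = _
    cases b j i
    · rw [bernoulliMeasure_apply_of_notMem_of_mem _ (hdec (measurableSet_singleton _)),
        bernoulliMeasure_apply_of_notMem_of_mem _ (measurableSet_singleton _)] <;> simp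
    · rw [bernoulliMeasure_apply_of_mem_of_notMem _ (hdec (measurableSet_singleton _)),
        bernoulliMeasure_apply_of_mem_of_notMem _ (measurableSet_singleton _)] <;> simp
  · have h01 : ∀ᵐ ω ∂P, ∀ (i : Fin n) (j : Fin m), A ω i j = 1 ∨ A ω i j = 0 := by
      refine ae_all_iff.2 fun i => ae_all_iff.2 fun j => ?_
      have hm : MeasurableSet {x : ℝ | ¬ (x = 1 ∨ x = 0)} := by
        have : {x : ℝ | ¬ (x = 1 ∨ x = 0)} = ({1, 0} : Set ℝ)ᶜ := by
          ext x
          simp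
        rw [this]
        exact (Set.toFinite _).measurableSet.compl
      rw [ae_iff, (h.law i j).measure_eq (p := fun x => ¬ (x = 1 ∨ x = 0)) hm, bernoulliLaw]
      exact bernoulliMeasure_apply_of_notMem_of_notMem _ hm (by simp) (by simp)
    filter_upwards [h01] with ω hω
    ext i j
    rw [boolMatrix_apply]
    rcases hω i j with h | h <;> simp [h]

theorem ae_tendsto_stieltjesSum {α c : ℝ} (hα : 0 < α) (hc : 0 < c) {m : ℕ → ℕ}
    (hm : Tendsto (fun n : ℕ => (m n : ℝ) / n) atTop (𝓝 α)) {μ : Measure ℝ}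
    [IsProbabilityMeasure μ] (hμ : HasNonnegMoments μ (limitMoment α c))
    {Ω : Type*} [MeasurableSpace Ω] {P : Measure Ω}
    {A : (n : ℕ) → Ω → Matrix (Fin n) (Fin (m n)) ℝ}
    (hA : ∀ n : ℕ, 1 ≤ n → ∀ p : unitInterval, (p : ℝ) = c / n →
      HasIIDEntries P (A n) (bernoulliLaw p)) {s : ℝ} (hs : 0 < s) :
    ∀ᵐ ω ∂P, Tendsto (fun n : ℕ => (n : ℝ)⁻¹ * stieltjesSum c s (A n ω)) atTop
      (𝓝 (∫ x, (x + s)⁻¹ ∂μ)) := by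
  have hex : ∀ n : ℕ, ∃ B : Ω → Fin (m n) → Fin n → Bool, ⌈c⌉₊ + 1 ≤ n →
      (AEMeasurable B P ∧ P.map B = boolLaw n (m n) (bernoulliParam c n)) ∧
        ∀ᵐ ω ∂P, A n ω = boolMatrix (B ω) := by
    intro n
    by_cases hn : ⌈c⌉₊ + 1 ≤ n
    · obtain ⟨B, h1, h2, h3⟩ := (hA n (by omega) _ (coe_bernoulliParam hc hn)).boolMatrix
      exact ⟨B, fun _ => ⟨⟨h1, h2⟩, h3⟩⟩
    -- An arbitrary value for the finitely many small `n`, which do not affect the limit.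
    · exact ⟨fun _ _ _ => true, fun h => absurd h hn⟩
  choose B hB using hex
  have heq : ∀ᵐ ω ∂P, ∀ n, ⌈c⌉₊ + 1 ≤ n → A n ω = boolMatrix (B n ω) := by
    refine ae_all_iff.2 fun n => ?_
    by_cases hn : ⌈c⌉₊ + 1 ≤ n
    · filter_upwards [(hB n hn).2] with ω hω _ using hω
    · exact ae_of_all _ fun ω h => absurd h hn
  filter_upwards [heq, ae_tendsto_stieltjesSum_boolMatrix hα hc hm hμ
    (fun n hn => (hB n hn).1) hs] with ω h1 h2
  refine h2.congr' ?_
  filter_upwards [eventually_ge_atTop (⌈c⌉₊ + 1)] with n hn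
  rw [h1 n hn]

theorem HasIIDEntries.add_const {Ω : Type*} [MeasurableSpace Ω] {P : Measure Ω}
    {n m : ℕ} {X : Ω → Matrix (Fin n) (Fin m) ℝ} {p : unitInterval}
    (h : HasIIDEntries P X (centeredBernoulliLaw p)) :
    HasIIDEntries P (fun ω => X ω + Matrix.of fun _ _ => (p : ℝ)) (bernoulliLaw p) where
  indep := h.indep.comp (fun _ x => x + (p : ℝ)) fun _ => by fun_prop
  law i j := by
    have hm : Measurable fun x : ℝ => x + (p : ℝ) := by fun_prop
    refine ⟨hm.comp_aemeasurable (h.law i j).aemeasurable, ?_⟩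
    have h1 : P.map (fun ω => X ω i j + (p : ℝ)) =
        (P.map fun ω => X ω i j).map fun x => x + (p : ℝ) :=
      (AEMeasurable.map_map_of_aemeasurable hm.aemeasurable (h.law i j).aemeasurable).symm
    refine h1.trans ?_
    rw [(h.law i j).map_eq, centeredBernoulliLaw, bernoulliLaw, bernoulliMeasure_def,
      bernoulliMeasure_def, Measure.map_add _ _ hm, Measure.map_smul, Measure.map_smul,
      Measure.map_dirac' hm, Measure.map_dirac' hm]
    simp

/-- The shift back to Bernoulli entries is a rank-one matrix, so the normalized transforms differ by
at most `2 / (s n)`. -/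
theorem ae_tendsto_stieltjesSum_centered {α c : ℝ} (hα : 0 < α) (hc : 0 < c) {m : ℕ → ℕ}
    (hm : Tendsto (fun n : ℕ => (m n : ℝ) / n) atTop (𝓝 α)) {μ : Measure ℝ}
    [IsProbabilityMeasure μ] (hμ : HasNonnegMoments μ (limitMoment α c))
    {Ω : Type*} [MeasurableSpace Ω] {P : Measure Ω}
    {X : (n : ℕ) → Ω → Matrix (Fin n) (Fin (m n)) ℝ}
    (hX : ∀ n : ℕ, 1 ≤ n → ∀ p : unitInterval, (p : ℝ) = c / n →
      HasIIDEntries P (X n) (centeredBernoulliLaw p)) {s : ℝ} (hs : 0 < s) :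
    ∀ᵐ ω ∂P, Tendsto (fun n : ℕ => (n : ℝ)⁻¹ * stieltjesSum c s (X n ω)) atTop
      (𝓝 (∫ x, (x + s)⁻¹ ∂μ)) := by
  have h := ae_tendsto_stieltjesSum hα hc hm hμ (P := P)
    (A := fun n ω => X n ω + Matrix.of fun _ _ => c / n)
    (fun n hn p hp => by
      rw [← hp]
      exact (hX n hn p hp).add_const) hs
  filter_upwards [h] with ω hω
  have hdiff : Tendsto (fun n : ℕ => (n : ℝ)⁻¹ * stieltjesSum c s (X n ω) - (n : ℝ)⁻¹ *
      stieltjesSum c s (X n ω + Matrix.of fun _ _ => c / n)) atTop (𝓝 0) := by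
    have h0 : Tendsto (fun n : ℕ => (n : ℝ)⁻¹ * (2 * s⁻¹)) atTop (𝓝 0) := by
      simpa using (tendsto_inv_atTop_nhds_zero_nat (𝕜 := ℝ)).mul_const (2 * s⁻¹)
    refine squeeze_zero_norm (fun n => ?_) h0
    rw [← mul_sub, norm_mul, Real.norm_eq_abs, Real.norm_eq_abs, abs_of_nonneg (by positivity)]
    refine mul_le_mul_of_nonneg_left (abs_stieltjesSum_sub_le hc hs _ _ ?_) (by positivity)
    have : X n ω - (X n ω + Matrix.of fun _ _ => c / n) =
        Matrix.vecMulVec (fun _ => -(c / n)) fun _ => 1 := by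
      ext i j
      simp [Matrix.vecMulVec_apply]
    rw [this]
    exact Matrix.rank_vecMulVec_le _ _
  simpa using hdiff.add hω

/-! ### Weak convergence of the spectral measures -/

theorem weaklyConverges_spectralMeasure_wishart {c : ℝ} (hc : 0 < c) {m : ℕ → ℕ} {μ : Measure ℝ}
    [IsProbabilityMeasure μ] (hμ : ∀ᵐ x ∂μ, 0 ≤ x) {X : (n : ℕ) → Matrix (Fin n) (Fin (m n)) ℝ}
    (h : ∀ q : ℕ, Tendsto (fun n : ℕ => (n : ℝ)⁻¹ * stieltjesSum c (1 + 1 / (q + 1 : ℝ)) (X n)) atTop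
      (𝓝 (∫ x, (x + (1 + 1 / (q + 1 : ℝ)))⁻¹ ∂μ))) :
    WeaklyConverges (fun n => spectralMeasure (wishart_isHermitian c (X n))) μ := by
  -- The index is shifted by one because the spectral measure of the empty matrix is zero.
  have hp : ∀ n, IsProbabilityMeasure (spectralMeasure (wishart_isHermitian c (X (n + 1)))) :=
    fun n => isProbabilityMeasure_spectralMeasure n.succ_ne_zero _
  have hw := weaklyConverges_of_stieltjes
    (ν := fun n => spectralMeasure (wishart_isHermitian c (X (n + 1))))
    (fun n => ae_nonneg_spectralMeasure hc _) hμ fun q => by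
      simp only [integral_inv_add_spectralMeasure]
      exact (tendsto_add_atTop_iff_nat 1).2 (h q)
  exact fun f => (tendsto_add_atTop_iff_nat 1).1 (hw f)

theorem theorem2 :
    ∃ μ : ℝ → ℝ → Measure ℝ, ∀ α c : ℝ, 0 < α → 0 < c →
      IsProbabilityMeasure (μ α c) ∧
      ∀ (Ω : Type*) [MeasurableSpace Ω] (P : Measure Ω) [IsProbabilityMeasure P]
        (m : ℕ → ℕ), Tendsto (fun n : ℕ => (m n : ℝ) / (n : ℝ)) atTop (𝓝 α) →
        -- non-centered entries
        (∀ A : (n : ℕ) → Ω → Matrix (Fin n) (Fin (m n)) ℝ,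
          (∀ n : ℕ, 1 ≤ n → ∀ p : unitInterval, (p : ℝ) = c / n →
            HasIIDEntries P (A n) (bernoulliLaw p)) →
          ∀ᵐ ω ∂P, WeaklyConverges
            (fun n => spectralMeasure (wishart_isHermitian c (A n ω))) (μ α c)) ∧
        -- centered entries
        (∀ X : (n : ℕ) → Ω → Matrix (Fin n) (Fin (m n)) ℝ,
          (∀ n : ℕ, 1 ≤ n → ∀ p : unitInterval, (p : ℝ) = c / n →
            HasIIDEntries P (X n) (centeredBernoulliLaw p)) →
          ∀ᵐ ω ∂P, WeaklyConverges
            (fun n => spectralMeasure (wishart_isHermitian c (X n ω))) (μ α c)) := by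
  -- The law is fixed by its moments before `m` and the matrices are given; outside the range of
  -- parameters it is set to zero.
  have hex : ∀ α c : ℝ, ∃ μ : Measure ℝ, 0 < α → 0 < c →
      IsProbabilityMeasure μ ∧ HasNonnegMoments μ (limitMoment α c) := by
    intro α c
    by_cases h : 0 < α ∧ 0 < c
    · obtain ⟨μ, hμ⟩ := exists_hasNonnegMoments_limitMoment h.1 h.2
      exact ⟨μ, fun _ _ => ⟨μ.2, hμ⟩⟩
    · exact ⟨0, fun h1 h2 => absurd ⟨h1, h2⟩ h⟩
  choose μ hμ using hex
  refine ⟨μ, fun α c hα hc => ?_⟩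
  obtain ⟨hprob, hmom⟩ := hμ α c hα hc
  refine ⟨hprob, fun Ω _ P _ m hm => ⟨fun A hA => ?_, fun X hX => ?_⟩⟩
  -- Only countably many points `s` are needed, so a single null set suffices.
  · have h : ∀ᵐ ω ∂P, ∀ q : ℕ, Tendsto (fun n : ℕ => (n : ℝ)⁻¹ *
        stieltjesSum c (1 + 1 / (q + 1 : ℝ)) (A n ω)) atTop
        (𝓝 (∫ x, (x + (1 + 1 / (q + 1 : ℝ)))⁻¹ ∂(μ α c))) :=
      ae_all_iff.2 fun q => ae_tendsto_stieltjesSum hα hc hm hmom hA (by positivity)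
    filter_upwards [h] with ω hω
    exact weaklyConverges_spectralMeasure_wishart hc hmom.ae_nonneg hω
  · have h : ∀ᵐ ω ∂P, ∀ q : ℕ, Tendsto (fun n : ℕ => (n : ℝ)⁻¹ *
        stieltjesSum c (1 + 1 / (q + 1 : ℝ)) (X n ω)) atTop
        (𝓝 (∫ x, (x + (1 + 1 / (q + 1 : ℝ)))⁻¹ ∂(μ α c))) :=
      ae_all_iff.2 fun q => ae_tendsto_stieltjesSum_centered hα hc hm hmom hX (by positivity)
    filter_upwards [h] with ω hω
    exact weaklyConverges_spectralMeasure_wishart hc hmom.ae_nonneg hω
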